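/- Let $G$ be a (finite-dimensional, real, smooth) Lie group with Lie algebra $\mathfrak g=T_eG$, whose bracket is that of left-invariant vector fields. Let $\langle\cdot,\cdot\rangle$ be the duality pairing. For $v\in T_gG$ and $p\in T_g^*G$ write $g^{-1}\cdot v=T_gL_{g^{-1}}v\in\mathfrak g$ and $g^*p=p\circ T_eL_g\in\mathfrak g^*$, where $L_g(x)=gx$. For $\xi\in\mathfrak g$ let $\mathrm{ad}^*_\xi$ be defined by $\langle \mathrm{ad}^*_\xi\mu,\eta\rangle=\langle\mu,[\xi,\eta]\rangle$. Let $U$ be a manifold of parameters (for example a normed vector space), and let $F$ be a parameter-dependent vector field on $G$, $F(g,u)\in T_gG$, which is continuously differentiable in $(g,u)\in G\times U$. Let $f(g,u)=g^{-1}\cdot F(g,u)\in\mathfrak g$ be its left-trivialization, with partial derivatives $D_gf(g,u):T_gG\to\mathfrak g$ and $\frac{\partial f}{\partial u}(g,u):T_uU\to\mathfrak g$. Let $C:G\to\mathbb R$ be differentiable, $T>0$ and $g_0\in G$. Suppose that for every $u\in U$ there is a curve $g_u:[0,T]\to G$ with $\dot g_u(t)=F(g_u(t),u)$ on $[0,T]$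 and $g_u(0)=g_0$. For a curve $\mu:[0,T]\to\mathfrak g^*$ put $$J_\mu(u)=C(g_u(T))-\int_0^T\langle\mu,\ \xi_u-f(g_u,u)\rangle\,dt,\qquad \xi_u=g_u^{-1}\cdot\dot g_u .$$ Fix $u\in U$ and write $g=g_u$, $\xi=\xi_u$. Then there is a curve $\mu:[0,T]\to\mathfrak g^*$ that solves the left-trivialized adjoint equation with terminal condition $$-\dot\mu+\mathrm{ad}^*_\xi\mu-g^*[D_gf(g,u)]^*\mu=0\ \text{ on }[0,T],\qquad \mu(T)=g(T)^*dC(g(T)).$$ For every such $\mu$, the functions $w\mapsto C(g_w(T))$ and $w\mapsto J_\mu(w)$ on $U$ are differentiable at $u$, the function $t\mapsto\langle\mu(t),\frac{\partial f}{\partial u}(g(t),u)v\rangle$ is integrable on $[0,T]$ for every $v\in T_uU$, and $$\frac{d}{du}C(g(T))=\frac{d}{du}J_\mu=\int_0^T\Big\langle\mu,\frac{\partial f}{\partial u}(g,u)\Big\rangle\,dt ,$$ as linear functionals on $T_uU$ (that is, evaluated at every $v\in T_uU$). -/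

import Mathlib

open Set MeasureTheory
open scoped Manifold ContDiff Topology

noncomputable section

/-! Left trivialization on a real Lie group `G`. The Lie algebra `𝔤 = T_e G` is Mathlib's
`GroupLieAlgebra I G`, with the bracket of left-invariant vector fields, and its dual `𝔤*` is
`GroupLieAlgebra I G →L[ℝ] ℝ`. -/

section LeftTrivialization

variable {E : Type*} [NormedAddCommGroup E] [NormedSpace ℝ E]
  {H : Type*} [TopologicalSpace H] {I : ModelWithCorners ℝ E H}
  {G : Type*} [TopologicalSpace G] [ChartedSpace H G] [Group G]

/-- A smooth Lie group has the smoothness that Mathlib asks for in order to define the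
Lie algebra structure on `T_e G`. -/
instance lieGroup_minSmoothness_of_smooth [LieGroup I ∞ G] :
    LieGroup I (minSmoothness ℝ 3) G :=
  LieGroup.of_le (n := ∞) (by
    rw [minSmoothness_of_isRCLikeNormedField]
    exact WithTop.coe_le_coe.2 (le_top : (3 : ℕ∞) ≤ ⊤))

/-- `g⁻¹ · v`, the image of `v ∈ T_g G` in `𝔤` under the tangent map of `x ↦ g⁻¹ x`. -/
def leftTriv (g : G) (v : TangentSpace I g) : GroupLieAlgebra I G :=
  mfderiv I I (fun x : G => g⁻¹ * x) g v

/-- The tangent map `T_e L_g : 𝔤 → T_g G` of left translation `L_g x = g x`. -/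
def tangentLeft (g : G) : GroupLieAlgebra I G →L[ℝ] TangentSpace I g :=
  mfderiv I I (fun x : G => g * x) (1 : G)

/-- `g^* p = p ∘ T_e L_g`, the left translation of a covector `p ∈ T_g^* G` to `𝔤*`. -/
def leftTrivDual (g : G) (p : TangentSpace I g →L[ℝ] ℝ) : GroupLieAlgebra I G →L[ℝ] ℝ :=
  p.comp (tangentLeft g)

/-- The differential `dC(g) ∈ T_g^* G` of a function `C : G → ℝ`. -/
def diffAt (C : G → ℝ) (g : G) : TangentSpace I g →L[ℝ] ℝ :=
  mfderiv I 𝓘(ℝ, ℝ) C g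

/-- The coadjoint operator: `⟨ad^*_ξ μ, η⟩ = ⟨μ, [ξ, η]⟩`. -/
def coad [FiniteDimensional ℝ E] [LieGroup I ∞ G]
    (ξ : GroupLieAlgebra I G) (μ : GroupLieAlgebra I G →L[ℝ] ℝ) :
    GroupLieAlgebra I G →L[ℝ] ℝ where
  toLinearMap := μ.toLinearMap ∘ₗ LieAlgebra.ad ℝ (GroupLieAlgebra I G) ξ
  cont := by
    let φ : GroupLieAlgebra I G →ₗ[ℝ] ℝ := μ.toLinearMap ∘ₗ LieAlgebra.ad ℝ (GroupLieAlgebra I G) ξ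
    let ψ : E →ₗ[ℝ] ℝ := { toFun := φ, map_add' := φ.map_add, map_smul' := φ.map_smul }
    exact ψ.continuous_of_finiteDimensional

theorem coad_apply [FiniteDimensional ℝ E] [LieGroup I ∞ G]
    (ξ : GroupLieAlgebra I G) (μ : GroupLieAlgebra I G →L[ℝ] ℝ) (η : GroupLieAlgebra I G) :
    coad ξ μ η = μ ⁅ξ, η⁆ := rfl

/-- The left-trivialized velocity `ξ(t) = g(t)⁻¹ · ġ(t)` of a curve `g` on `[0, T]`. -/
def leftVelocity (I : ModelWithCorners ℝ E H) (T : ℝ) (g : ℝ → G) (t : ℝ) :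
    GroupLieAlgebra I G :=
  leftTriv (g t) (mfderivWithin 𝓘(ℝ, ℝ) I g (Icc 0 T) t (1 : ℝ))

variable {V : Type*} [NormedAddCommGroup V] [NormedSpace ℝ V]
  {K : Type*} [TopologicalSpace K] {J : ModelWithCorners ℝ V K}
  {U : Type*} [TopologicalSpace U] [ChartedSpace K U]

/-- The left-trivialization `f(g, u) = g⁻¹ · F(g, u) ∈ 𝔤` of a parameter-dependent vector
field `F`. -/
def leftField (F : (x : G) → U → TangentSpace I x) (x : G) (u : U) : GroupLieAlgebra I G :=
  leftTriv x (F x u)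

/-- `D_g f(g, u) : T_g G → 𝔤`. Here `𝔤 = T_e G`, which has `E` as underlying vector space,
is the fixed target vector space. -/
def leftFieldDg (F : (x : G) → U → TangentSpace I x) (x : G) (u : U) :
    TangentSpace I x →L[ℝ] GroupLieAlgebra I G :=
  mfderiv (M' := E) I 𝓘(ℝ, E) (fun y => leftField F y u) x

/-- `∂f/∂u (g, u) : T_u U → 𝔤`. -/
def leftFieldDu (J : ModelWithCorners ℝ V K) (F : (x : G) → U → TangentSpace I x)
    (x : G) (u : U) : TangentSpace J u →L[ℝ] GroupLieAlgebra I G :=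
  mfderiv (M' := E) J 𝓘(ℝ, E) (fun w => leftField F x w) u

/-- `μ : [0, T] → 𝔤*` satisfies the left-trivialized adjoint equation
`-μ̇ + ad^*_ξ μ - g^* [D_g f(g, u)]^* μ = 0` along the curve `g`, with `ξ = g⁻¹ ġ`, and the
terminal condition `μ(T) = g(T)^* dC(g(T))`. -/
structure IsAdjointSolution [FiniteDimensional ℝ E] [LieGroup I ∞ G]
    (F : (x : G) → U → TangentSpace I x) (C : G → ℝ) (T : ℝ) (u : U) (g : ℝ → G)
    (μ : ℝ → (GroupLieAlgebra I G →L[ℝ] ℝ)) : Prop where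
  adjoint_eq : ∀ t ∈ Icc (0 : ℝ) T, ∃ μ' : GroupLieAlgebra I G →L[ℝ] ℝ,
    HasDerivWithinAt μ μ' (Icc 0 T) t ∧
    -μ' + coad (leftVelocity I T g t) (μ t)
      - leftTrivDual (g t) ((μ t).comp (leftFieldDg F (g t) u)) = 0
  terminal : μ T = leftTrivDual (g T) (diffAt C (g T))

/-- The augmented cost `J = C(g(T)) - ∫₀ᵀ ⟨μ, ξ - f(g, u)⟩ dt`, with `ξ = g⁻¹ ġ`. -/
def augmentedCost (F : (x : G) → U → TangentSpace I x) (C : G → ℝ) (T : ℝ)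
    (μ : ℝ → (GroupLieAlgebra I G →L[ℝ] ℝ)) (g : ℝ → G) (u : U) : ℝ :=
  C (g T) - ∫ t in (0 : ℝ)..T, μ t (leftVelocity I T g t - leftField F (g t) u)

end LeftTrivialization

end

/-! Compare `g_w` with `g = g_u` through the quotient `k_w = g⁻¹ g_w`. It starts at `e`, so for `w`
near `u` it stays near `e` on all of `[0, T]`, and a single chart around `e` serves the whole
interval although `g` may cross many charts.

Write `m` for the multiplication in that chart. The coordinate `y_w` of `k_w` solves `y' = D₂m(y, e)
f(g·y, w) - D₁m(e, y) f(g, u)` (`hasDerivWithinAt_quotient`). The right-hand side vanishes at `(e,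
u)`. Its linearization there is `(δ, v) ↦ D_g f (T L_g δ) - [ξ, δ] + ∂f/∂u v`, because the bracket
is the antisymmetrized mixed second derivative of `m` at `(e, e)`
(`bracket_eq_fderiv_fderiv_localMul`, `quotientDeriv_inl`, `quotientDeriv_inr`). The adjoint
equation is therefore minus the transpose of the `δ`-part (`adjoint_rhs`), and a solution exists by
linear ODE theory.

Grönwall gives `y_w - e = O(w - u)` (`exists_chartQuotient_bound`). In the derivative of `⟨μ, y_w -
e⟩` the terms linear in `y_w - e` cancel, leaving `⟨μ, ∂f/∂u (w - u)⟩ + o(w - u)` uniformly in `t`;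
integration differentiates `⟨μ(T), y_w(T) - e⟩` (`hasFDerivAt_of_adjoint`). The terminal condition
makes `μ(T)` the differential of `C` at `g(T)` in these coordinates, so this is also the derivative
of `C(g_w(T))`. The flow itself is never differentiated in `w`. Finally `J_μ` equals `C(g_w(T))`
identically, since the constraint vanishes along integral curves. -/

section Analysis

/-! ### Linear differential equations on a compact interval -/

/-- Derivatives within two adjacent intervals glue to a derivative within their union. -/
theorem HasDerivWithinAt.glue_Icc {X : Type*} [NormedAddCommGroup X] [NormedSpace ℝ X]
    {f₁ f₂ : ℝ → X} {f' : ℝ → X → X} {a b c : ℝ} (hab : a ≤ b) (hbc : b ≤ c)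
    (h₁ : ∀ t ∈ Icc a b, HasDerivWithinAt f₁ (f' t (f₁ t)) (Icc a b) t)
    (h₂ : ∀ t ∈ Icc b c, HasDerivWithinAt f₂ (f' t (f₂ t)) (Icc b c) t)
    (h : f₁ b = f₂ b) :
    ∃ f : ℝ → X, f c = f₂ c ∧ ∀ t ∈ Icc a c, HasDerivWithinAt f (f' t (f t)) (Icc a c) t := by
  have e₁ : EqOn (fun t => if t ≤ b then f₁ t else f₂ t) f₁ (Icc a b) := fun t ht => if_pos ht.2
  have e₂ : EqOn (fun t => if t ≤ b then f₁ t else f₂ t) f₂ (Icc b c) := by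
    intro t ht
    rcases ht.1.eq_or_lt with rfl | hlt
    · simpa using h
    · exact if_neg (not_le.2 hlt)
  refine ⟨fun t => if t ≤ b then f₁ t else f₂ t, e₂ (right_mem_Icc.2 hbc), fun t ht => ?_⟩
  have d₁ : t ∈ Icc a b → HasDerivWithinAt (fun t => if t ≤ b then f₁ t else f₂ t)
      (f' t (if t ≤ b then f₁ t else f₂ t)) (Icc a b) t := by
    intro ht
    have := (h₁ t ht).congr_of_mem e₁ ht
    rwa [← e₁ ht] at this
  have d₂ : t ∈ Icc b c → HasDerivWithinAt (fun t => if t ≤ b then f₁ t else f₂ t)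
      (f' t (if t ≤ b then f₁ t else f₂ t)) (Icc b c) t := by
    intro ht
    have := (h₂ t ht).congr_of_mem e₂ ht
    rwa [← e₂ ht] at this
  rcases lt_trichotomy t b with hlt | rfl | hgt
  · refine (d₁ ⟨ht.1, hlt.le⟩).mono_of_mem_nhdsWithin ?_
    filter_upwards [self_mem_nhdsWithin, mem_nhdsWithin_of_mem_nhds (Iio_mem_nhds hlt)] with s hs hs'
    exact ⟨hs.1, le_of_lt hs'⟩
  · rw [← Icc_union_Icc_eq_Icc hab hbc]
    exact (d₁ ⟨hab, le_rfl⟩).union (d₂ ⟨le_rfl, hbc⟩)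
  · refine (d₂ ⟨hgt.le, ht.2⟩).mono_of_mem_nhdsWithin ?_
    filter_upwards [self_mem_nhdsWithin, mem_nhdsWithin_of_mem_nhds (Ioi_mem_nhds hgt)] with s hs hs'
    exact ⟨le_of_lt hs', hs.2⟩

/-- A linear differential equation with bounded continuous coefficients is solvable backwards in
time on a short interval, whose length depends only on the bound. -/
theorem exists_linear_ode_short {X : Type*} [NormedAddCommGroup X] [NormedSpace ℝ X]
    [CompleteSpace X] {A : ℝ → X →L[ℝ] X} {a b M : ℝ} (hM : 0 < M) (hab : a ≤ b)
    (hA : ContinuousOn A (Icc a b)) (hAM : ∀ t ∈ Icc a b, ‖A t‖ ≤ M)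
    (hlen : (b - a) * (2 * M) ≤ 1) (x₁ : X) :
    ∃ x : ℝ → X, x b = x₁ ∧ ∀ t ∈ Icc a b, HasDerivWithinAt x (A t (x t)) (Icc a b) t := by
  -- On the ball of radius `r` around `x₁` one has `‖x‖ ≤ 2r`, so the speed is at most `2Mr` and the
  -- displacement in time `1/(2M)` at most `r`. The initial time is the right endpoint `b`.
  let r : NNReal := ‖x₁‖₊ + 1
  have hr : (r : ℝ) = ‖x₁‖ + 1 := rfl
  let t₀ : Icc a b := ⟨b, right_mem_Icc.2 hab⟩
  have hp : IsPicardLindelof (fun t x => A t x) t₀ x₁ r 0 (⟨M, hM.le⟩ * (2 * r)) ⟨M, hM.le⟩ := by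
    refine ⟨fun t ht => ?_, fun x _ => ?_, fun t ht x hx => ?_, ?_⟩
    · exact ((A t).lipschitz.weaken (hAM t ht)).lipschitzOnWith
    · exact hA.clm_apply continuousOn_const
    · have hx' : ‖x‖ ≤ 2 * r := by
        have : ‖x‖ ≤ ‖x₁‖ + r := norm_le_of_mem_closedBall hx
        linarith
      exact ((A t).le_opNorm x).trans
        (mul_le_mul (hAM t ht) hx' (norm_nonneg _) hM.le)
    · have h0 : max (b - b) (b - a) = b - a := by simp [hab]
      change M * (2 * r) * max (b - b) (b - a) ≤ (r : ℝ) - 0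
      rw [h0]
      nlinarith [norm_nonneg x₁]
  exact hp.exists_eq_forall_mem_Icc_hasDerivWithinAt₀

/-- Global existence for linear differential equations with continuous coefficients on a compact
interval, with prescribed terminal value. -/
theorem exists_linear_ode {X : Type*} [NormedAddCommGroup X] [NormedSpace ℝ X]
    [CompleteSpace X] {A : ℝ → X →L[ℝ] X} {T : ℝ} (hT : 0 ≤ T)
    (hA : ContinuousOn A (Icc 0 T)) (x₁ : X) :
    ∃ x : ℝ → X, x T = x₁ ∧ ∀ t ∈ Icc 0 T, HasDerivWithinAt x (A t (x t)) (Icc 0 T) t := by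
  obtain ⟨M', hM'⟩ := isCompact_Icc.exists_bound_of_continuousOn hA
  let M := max M' 1
  have hM : 0 < M := lt_of_lt_of_le one_pos (le_max_right _ _)
  have hAM : ∀ t ∈ Icc 0 T, ‖A t‖ ≤ M := fun t ht => (hM' t ht).trans (le_max_left _ _)
  let d := 1 / (2 * M)
  have hd : 0 < d := by positivity
  have hdM : d * (2 * M) = 1 := by simp only [d]; field_simp
  -- Backward continuation from `T` in `n` steps of length at most `d`; by linearity `d` does not
  -- depend on the value reached.
  have key : ∀ n : ℕ, ∀ a ∈ Icc 0 T, T - a ≤ n * d → ∃ x : ℝ → X, x T = x₁ ∧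
      ∀ t ∈ Icc a T, HasDerivWithinAt x (A t (x t)) (Icc a T) t := by
    intro n
    induction n with
    | zero =>
      intro a ha h
      have : a = T := le_antisymm ha.2 (by simpa using h)
      subst this
      exact exists_linear_ode_short hM le_rfl (hA.mono (Icc_subset_Icc ha.1 le_rfl))
        (fun t ht => hAM t ⟨ha.1.trans ht.1, ht.2⟩) (by simp) x₁
    | succ n ih =>
      intro a ha h
      push_cast at h
      have hb : min (a + d) T ∈ Icc 0 T :=
        ⟨le_min (by linarith [ha.1]) hT, min_le_right _ _⟩
      have hab : a ≤ min (a + d) T := le_min (by linarith) ha.2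
      obtain ⟨x, hx, hx'⟩ := ih (min (a + d) T) hb (by
        rcases min_choice (a + d) T with h' | h' <;> rw [h']
        · linarith
        · have : 0 ≤ n * d := by positivity
          linarith)
      obtain ⟨z, hz, hz'⟩ := exists_linear_ode_short hM hab
        (hA.mono (Icc_subset_Icc ha.1 hb.2)) (fun t ht => hAM t ⟨ha.1.trans ht.1, ht.2.trans hb.2⟩)
        (by
          rw [← hdM]
          have := min_le_left (a + d) T
          gcongr
          linarith) (x (min (a + d) T))
      obtain ⟨y, hy, hy'⟩ := HasDerivWithinAt.glue_Icc hab hb.2 hz' hx' hz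
      exact ⟨y, hy.trans hx, hy'⟩
  obtain ⟨n, hn⟩ := exists_nat_ge (T / d)
  exact key n 0 ⟨le_rfl, hT⟩ (by rw [div_le_iff₀ hd] at hn; simpa using hn)

/-! ### Parameter dependence of differential equations in normed spaces -/

/-- A curve that starts in a closed set `S` and does not leave `S` as long as it stays in an open
neighbourhood `W` of `S` stays in `S`. -/
theorem forall_mem_Icc_of_no_exit {X : Type*} [TopologicalSpace X] {h : ℝ → X} {T : ℝ}
    (hc : ContinuousOn h (Icc 0 T)) {S W : Set X} (hW : IsOpen W) (hS : IsClosed S)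
    (hSW : S ⊆ W) (h0 : h 0 ∈ S)
    (step : ∀ b ∈ Icc 0 T, (∀ s ∈ Icc 0 b, h s ∈ W) → h b ∈ S) :
    ∀ t ∈ Icc 0 T, h t ∈ S := by
  -- The endpoint `b` can be dropped from the assumption: `h b` is a limit of points of the closed
  -- set `S`.
  have claim : ∀ b ∈ Icc 0 T, (∀ s ∈ Ico 0 b, h s ∈ W) → h b ∈ S := by
    intro b hb hs
    rcases hb.1.eq_or_lt with rfl | hb0
    · exact h0
    have hcb : ContinuousWithinAt h (Ico 0 b) b :=
      (hc b hb).mono (fun s hs' => ⟨hs'.1, hs'.2.le.trans hb.2⟩)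
    have hbc : b ∈ closure (Ico 0 b) := by
      rw [closure_Ico hb0.ne]; exact right_mem_Icc.2 hb.1
    have := hcb.mem_closure hbc (t := S) (fun s hs' => step s ⟨hs'.1, hs'.2.le.trans hb.2⟩
      (fun r hr => hs r ⟨hr.1, hr.2.trans_lt hs'.2⟩))
    rwa [hS.closure_eq] at this
  have inW : ∀ t ∈ Icc 0 T, h t ∈ W := by
    by_contra! hcon
    obtain ⟨t, ht, htW⟩ := hcon
    -- At the first exit time `sInf B`, `claim` puts the curve in `S ⊆ W`, a contradiction.
    let B := Icc 0 T ∩ h ⁻¹' Wᶜ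
    have hB : IsClosed B := hc.preimage_isClosed_of_isClosed isClosed_Icc hW.isClosed_compl
    have hBne : B.Nonempty := ⟨t, ht, htW⟩
    have hBbd : BddBelow B := ⟨0, fun s hs => hs.1.1⟩
    have hb := hB.csInf_mem hBne hBbd
    refine hb.2 (hSW (claim _ hb.1 fun s hs => ?_))
    by_contra hsW
    exact absurd (csInf_le hBbd ⟨⟨hs.1, hs.2.le.trans hb.1.2⟩, hsW⟩) (not_le.2 hs.2)
  exact fun t ht => claim t ht fun s hs => inW s ⟨hs.1, hs.2.le.trans ht.2⟩

/-- Grönwall estimate for a curve starting at `x₀`. -/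
theorem norm_sub_le_of_norm_deriv_le_mul_add {E : Type*} [NormedAddCommGroup E] [NormedSpace ℝ E]
    {y y' : ℝ → E} {x₀ : E} {b M d : ℝ} (hM : 0 < M) (hb : 0 ≤ b)
    (hd : 0 ≤ d) (h0 : y 0 = x₀)
    (hy : ∀ t ∈ Icc 0 b, HasDerivWithinAt y (y' t) (Icc 0 b) t)
    (hbd : ∀ t ∈ Icc 0 b, ‖y' t‖ ≤ M * (‖y t - x₀‖ + d)) :
    ‖y b - x₀‖ ≤ d * Real.exp (M * b) := by
  have := norm_le_gronwallBound_of_norm_deriv_right_le (f := fun t => y t - x₀) (f' := y')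
    (δ := 0) (K := M) (ε := M * d) (a := 0) (b := b)
    (fun t ht => ((hy t ht).continuousWithinAt.sub continuousWithinAt_const))
    (fun t ht => ((hy t ⟨ht.1, ht.2.le⟩).sub_const x₀).mono_of_mem_nhdsWithin
      (Icc_mem_nhdsGE_of_mem ht)) (by simp [h0])
    (fun t ht => (hbd t ⟨ht.1, ht.2.le⟩).trans (by rw [mul_add])) b ⟨hb, le_rfl⟩
  -- The Grönwall bound is `d (exp (M b) - 1)`; the `-1` is then dropped.
  rw [gronwallBound_of_K_ne_0 hM.ne'] at this
  refine this.trans ?_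
  simp only [sub_zero, zero_mul, zero_add, mul_div_cancel_left₀ _ hM.ne']
  nlinarith [Real.exp_pos (M * b)]

/-- A function `Φ(t, x, w)` whose first order expansion at `(x₀, w₀)` is uniform in `t` and has no
zeroth order term is bounded linearly near `(x₀, w₀)`, uniformly in `t`. -/
theorem exists_bound_of_uniform_expansion {E V : Type*} [NormedAddCommGroup E] [NormedSpace ℝ E]
    [NormedAddCommGroup V] [NormedSpace ℝ V] {T : ℝ} {x₀ : E} {w₀ : V}
    {Φ : ℝ → E → V → E} {L : ℝ → E × V →L[ℝ] E} (hL : ContinuousOn L (Icc 0 T))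
    (hΦ : ∀ ε > 0, ∀ᶠ q in 𝓝 (x₀, w₀), ∀ t ∈ Icc 0 T,
      ‖Φ t q.1 q.2 - L t (q - (x₀, w₀))‖ ≤ ε * ‖q - (x₀, w₀)‖) :
    ∃ M > 0, ∀ᶠ q in 𝓝 (x₀, w₀), ∀ t ∈ Icc 0 T,
      ‖Φ t q.1 q.2‖ ≤ M * (‖q.1 - x₀‖ + ‖q.2 - w₀‖) := by
  obtain ⟨N, hN⟩ := isCompact_Icc.exists_bound_of_continuousOn hL
  refine ⟨max N 0 + 1, by positivity, ?_⟩
  filter_upwards [hΦ 1 one_pos] with q hq t ht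
  have h1 : ‖Φ t q.1 q.2‖ ≤ ‖Φ t q.1 q.2 - L t (q - (x₀, w₀))‖ + ‖L t (q - (x₀, w₀))‖ := by
    simpa using norm_add_le (Φ t q.1 q.2 - L t (q - (x₀, w₀))) (L t (q - (x₀, w₀)))
  have h2 : ‖L t (q - (x₀, w₀))‖ ≤ max N 0 * ‖q - (x₀, w₀)‖ :=
    (L t).le_of_opNorm_le ((hN t ht).trans (le_max_left _ _)) _
  have h3 : ‖q - (x₀, w₀)‖ ≤ ‖q.1 - x₀‖ + ‖q.2 - w₀‖ :=
    max_le (le_add_of_nonneg_right (norm_nonneg _)) (le_add_of_nonneg_left (norm_nonneg _))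
  calc ‖Φ t q.1 q.2‖ ≤ (max N 0 + 1) * ‖q - (x₀, w₀)‖ := by linarith [hq t ht]
    _ ≤ _ := by gcongr

/-- Differentiation of a differential equation with respect to a parameter, tested against a
solution `μ` of the adjoint equation. -/
theorem hasFDerivAt_of_adjoint {E V : Type*} [NormedAddCommGroup E] [NormedSpace ℝ E]
    [NormedAddCommGroup V] [NormedSpace ℝ V] {T : ℝ} (hT : 0 ≤ T) {x₀ : E} {w₀ : V}
    {Φ : ℝ → E → V → E} {L : ℝ → E × V →L[ℝ] E} (hL : ContinuousOn L (Icc 0 T))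
    (hΦ : ∀ ε > 0, ∀ᶠ q in 𝓝 (x₀, w₀), ∀ t ∈ Icc 0 T,
      ‖Φ t q.1 q.2 - L t (q - (x₀, w₀))‖ ≤ ε * ‖q - (x₀, w₀)‖)
    {y : V → ℝ → E} (hy0 : ∀ w, y w 0 = x₀)
    (hy : ∀ᶠ w in 𝓝 w₀, ∀ t ∈ Icc 0 T, HasDerivWithinAt (y w) (Φ t (y w t) w) (Icc 0 T) t)
    {c : ℝ} (hc : ∀ᶠ w in 𝓝 w₀, ∀ t ∈ Icc 0 T, ‖y w t - x₀‖ ≤ ‖w - w₀‖ * c)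
    {μ : ℝ → E →L[ℝ] ℝ}
    (hμ : ∀ t ∈ Icc 0 T,
      HasDerivWithinAt μ (-(μ t).comp ((L t).comp (.inl ℝ E V))) (Icc 0 T) t) :
    HasFDerivAt (fun w => μ T (y w T - x₀))
      (∫ t in (0 : ℝ)..T, (μ t).comp ((L t).comp (.inr ℝ E V))) w₀ := by
  have hμc : ContinuousOn μ (Icc 0 T) := fun t ht => (hμ t ht).continuousWithinAt
  obtain ⟨N', hN'⟩ := isCompact_Icc.exists_bound_of_continuousOn hμc
  let N := max N' 0
  have hN : ∀ t ∈ Icc 0 T, ‖μ t‖ ≤ N := fun t ht => (hN' t ht).trans (le_max_left _ _)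
  have hN0 : 0 ≤ N := le_max_right _ _
  let c' := max c 0 + 1
  have hc0 : 0 < c' := by positivity
  have hint : ContinuousOn (fun t => (μ t).comp ((L t).comp (.inr ℝ E V))) (Icc 0 T) :=
    hμc.clm_comp (hL.clm_comp continuousOn_const)
  have hyw₀ : y w₀ T - x₀ = 0 := by
    have := hc.self_of_nhds T ⟨hT, le_rfl⟩
    simpa using this
  rw [hasFDerivAt_iff_isLittleO, Asymptotics.isLittleO_iff]
  intro δ hδ
  -- The final error is `N ε c' T ‖w - w₀‖`; the added ones keep the denominator positive.
  let ε := δ / ((N + 1) * c' * (T + 1))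
  have hε : 0 < ε := by positivity
  have hεδ : N * (ε * c') * T ≤ δ := by
    have h : (N + 1) * (ε * c') * (T + 1) = δ := by simp only [ε]; field_simp
    rw [← h]
    gcongr <;> linarith
  obtain ⟨r, hr, hΦr⟩ := Metric.eventually_nhds_iff.1 (hΦ ε hε)
  have hnear : ∀ᶠ w in 𝓝 w₀, c' * ‖w - w₀‖ < r := by
    have : Filter.Tendsto (fun w => c' * ‖w - w₀‖) (𝓝 w₀) (𝓝 (c' * ‖w₀ - w₀‖)) :=
      (by fun_prop : Continuous fun w => c' * ‖w - w₀‖).tendsto _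
    exact this.eventually_lt_const (by simpa using hr)
  filter_upwards [hy, hc, hnear] with w hyw hcw hw
  have hq : ∀ t ∈ Icc 0 T, ‖((y w t, w) : E × V) - (x₀, w₀)‖ ≤ c' * ‖w - w₀‖ := by
    intro t ht
    refine max_le ((hcw t ht).trans ?_) ?_
    · rw [mul_comm]
      gcongr
      simp only [c']
      linarith [le_max_left c 0]
    · change ‖w - w₀‖ ≤ _
      have : 1 ≤ c' := by simp [c']
      nlinarith [norm_nonneg (w - w₀)]
  have hintw : ContinuousOn (fun t => μ t (L t (0, w - w₀))) (Icc 0 T) :=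
    hμc.clm_apply (hL.clm_apply continuousOn_const)
  -- By the product rule `μ'` cancels the part of `L` linear in `y - x₀`, and the integral cancels
  -- the part linear in `w - w₀`. Only `μ` of the second-order remainder is left, and the mean value
  -- inequality applies.
  have hder : ∀ t ∈ Icc 0 T, HasDerivWithinAt
      (fun t => μ t (y w t - x₀) - ∫ s in (0 : ℝ)..t, μ s (L s (0, w - w₀)))
      (μ t (Φ t (y w t) w - L t ((y w t, w) - (x₀, w₀)))) (Icc 0 T) t := by
    intro t ht
    have h1 := (hμ t ht).clm_apply ((hyw t ht).sub_const x₀)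
    have h2 : HasDerivWithinAt (fun t => ∫ s in (0 : ℝ)..t, μ s (L s (0, w - w₀)))
        (μ t (L t (0, w - w₀))) (Icc 0 T) t := by
      have : Fact (t ∈ Icc 0 T) := ⟨ht⟩
      refine intervalIntegral.integral_hasDerivWithinAt_right
        ((hintw.mono (Icc_subset_Icc le_rfl ht.2)).intervalIntegrable_of_Icc ht.1)
        ?_ (hintw t ht)
      exact hintw.stronglyMeasurableAtFilter_nhdsWithin measurableSet_Icc t
    refine (h1.sub h2).congr_deriv ?_
    have h3 : ((y w t, w) : E × V) - (x₀, w₀) = (y w t - x₀, 0) + (0, w - w₀) := by simp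
    rw [h3]
    generalize y w t - x₀ = e
    simp only [map_sub, map_add, neg_apply, ContinuousLinearMap.comp_apply,
      ContinuousLinearMap.inl_apply]
    ring
  have hmv := norm_image_sub_le_of_norm_deriv_le_segment' hder
    (C := N * (ε * (c' * ‖w - w₀‖))) (fun t ht => by
      have ht' : t ∈ Icc 0 T := ⟨ht.1, ht.2.le⟩
      refine (μ t).le_of_opNorm_le_of_le (hN t ht') ?_
      refine (hΦr (y := (y w t, w)) ?_ t ht').trans ?_
      · rw [dist_eq_norm]
        exact (hq t ht').trans_lt hw
      · gcongr
        exact hq t ht') T ⟨hT, le_rfl⟩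
  have happ : (∫ t in (0 : ℝ)..T, (μ t).comp ((L t).comp (.inr ℝ E V))) (w - w₀) =
      ∫ t in (0 : ℝ)..T, μ t (L t (0, w - w₀)) := by
    rw [ContinuousLinearMap.intervalIntegral_apply (hint.intervalIntegrable_of_Icc hT)]
    rfl
  rw [happ, hyw₀, map_zero, sub_zero]
  simp only [hy0, sub_self, map_zero, intervalIntegral.integral_same, sub_zero] at hmv
  refine hmv.trans ?_
  calc N * (ε * (c' * ‖w - w₀‖)) * T = N * (ε * c') * T * ‖w - w₀‖ := by ring
    _ ≤ _ := by gcongr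

/-- First order expansion, locally uniform in an additional variable, of a `C¹` function that
vanishes along `q = q₀`. -/
theorem eventually_norm_sub_fderiv_right_le {X Y Z : Type*} [NormedAddCommGroup X]
    [NormedSpace ℝ X] [NormedAddCommGroup Y] [NormedSpace ℝ Y] [NormedAddCommGroup Z]
    [NormedSpace ℝ Z] {Ψ : X × Y → Z} {z₀ : X} {q₀ : Y} (hΨ : ContDiffAt ℝ 1 Ψ (z₀, q₀))
    (h0 : ∀ z, Ψ (z, q₀) = 0) :
    ContinuousAt (fun z => fderiv ℝ (fun q => Ψ (z, q)) q₀) z₀ ∧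
    ∀ ε > 0, ∀ᶠ p in 𝓝 (z₀, q₀),
      ‖Ψ p - fderiv ℝ (fun q => Ψ (p.1, q)) q₀ (p.2 - q₀)‖ ≤ ε * ‖p.2 - q₀‖ := by
  have hι : ContinuousAt (fun z : X => (z, q₀)) z₀ := by fun_prop
  have hev : (fun z => fderiv ℝ (fun q => Ψ (z, q)) q₀) =ᶠ[𝓝 z₀]
      fun z => (fderiv ℝ Ψ (z, q₀)).comp (.inr ℝ X Y) := by
    filter_upwards [hι.eventually (hΨ.eventually (by simp))] with z hz
    exact ((hz.differentiableAt (by simp)).hasFDerivAt.comp q₀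
      (hasFDerivAt_prodMk_right z q₀)).fderiv
  have hcont : ContinuousAt (fun z => fderiv ℝ (fun q => Ψ (z, q)) q₀) z₀ := by
    have h1 : ContinuousAt (fderiv ℝ Ψ) (z₀, q₀) :=
      (hΨ.fderiv_right (m := 0) (by simp)).continuousAt
    have h2 : ContinuousAt (fun z => fderiv ℝ Ψ (z, q₀)) z₀ :=
      ContinuousAt.comp (f := fun z : X => (z, q₀)) h1 hι
    exact (h2.clm_comp continuousAt_const).congr hev.symm
  refine ⟨hcont, fun ε hε => ?_⟩
  -- Strict differentiability allows both points `(z, q)` and `(z, q₀)` to move. It gives an error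
  -- `ε/2` with the derivative at `z₀`; replacing `z₀` by `z` costs another `ε/2`.
  have hstrict := (hΨ.hasStrictFDerivAt (by simp)).isLittleO
  have hs := (Asymptotics.isLittleO_iff.1 hstrict) (half_pos hε)
  have hpair : Filter.Tendsto (fun p : X × Y => (p, ((p.1, q₀) : X × Y))) (𝓝 (z₀, q₀))
      (𝓝 ((z₀, q₀), (z₀, q₀))) :=
    (by fun_prop : Continuous fun p : X × Y => (p, ((p.1, q₀) : X × Y))).tendsto' _ _ rfl
  set L : X → Y →L[ℝ] Z := fun z => fderiv ℝ (fun q => Ψ (z, q)) q₀ with hL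
  have hnear : ∀ᶠ p : X × Y in 𝓝 (z₀, q₀),
      ‖L z₀ - L p.1‖ < ε / 2 := by
    have h0 : ContinuousAt (fun p : X × Y => L p.1) (z₀, q₀) :=
      ContinuousAt.comp (g := L) (f := fun p : X × Y => p.1) hcont continuousAt_fst
    have h1 : ContinuousAt (fun p : X × Y => ‖L z₀ - L p.1‖) (z₀, q₀) :=
      (continuousAt_const.sub h0).norm
    exact h1.eventually_lt_const (by simpa using half_pos hε)
  have hz₀ : L z₀ = (fderiv ℝ Ψ (z₀, q₀)).comp (.inr ℝ X Y) :=
    hev.self_of_nhds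
  filter_upwards [hpair.eventually hs, hnear] with p hp hn
  have e1 : p - (p.1, q₀) = (0, p.2 - q₀) := by ext <;> simp
  have e2 : ‖((0, p.2 - q₀) : X × Y)‖ = ‖p.2 - q₀‖ := by simp [Prod.norm_def]
  have e3 : fderiv ℝ Ψ (z₀, q₀) (0, p.2 - q₀) = L z₀ (p.2 - q₀) := by
    rw [hz₀]; rfl
  simp only [h0, sub_zero, e1, e2, e3] at hp
  have h3 := (L z₀ - L p.1).le_of_opNorm_le hn.le (p.2 - q₀)
  have h4 := norm_add_le (Ψ p - L z₀ (p.2 - q₀)) ((L z₀ - L p.1) (p.2 - q₀))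
  rw [sub_apply, sub_add_sub_cancel] at h4
  rw [sub_apply] at h3
  change ‖Ψ p - L p.1 (p.2 - q₀)‖ ≤ _
  linarith

/-- A chain rule whose inner map need not be differentiable: the remainder of `c` is `o(z w - y₀)`,
hence `o(w - w₀)`, so it is enough that `ℓ (z w - y₀)` be differentiable. Testing against `μ(T)`
supplies exactly this. -/
theorem HasFDerivAt.comp_of_isBigO {X Y Z : Type*} [NormedAddCommGroup X]
    [NormedSpace ℝ X] [NormedAddCommGroup Y] [NormedSpace ℝ Y] [NormedAddCommGroup Z]
    [NormedSpace ℝ Z] {c : Y → Z} {ℓ : Y →L[ℝ] Z} {z : X → Y} {D : X →L[ℝ] Z} {w₀ : X} {y₀ : Y}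
    (hy₀ : z w₀ = y₀) (hc : HasFDerivAt c ℓ y₀)
    (hz : (fun w => z w - y₀) =O[𝓝 w₀] fun w => w - w₀)
    (hD : HasFDerivAt (fun w => ℓ (z w - y₀)) D w₀) :
    HasFDerivAt (fun w => c (z w)) D w₀ := by
  have hsub : Filter.Tendsto (fun w => w - w₀) (𝓝 w₀) (𝓝 0) :=
    (by fun_prop : Continuous fun w : X => w - w₀).tendsto' _ _ (sub_self w₀)
  have hzt : Filter.Tendsto z (𝓝 w₀) (𝓝 y₀) := by
    simpa using (hz.trans_tendsto hsub).add_const y₀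
  have h1 := (hc.isLittleO.comp_tendsto hzt).trans_isBigO hz
  refine hasFDerivAt_iff_isLittleO.2 ((h1.add hD.isLittleO).congr_left fun w => ?_)
  simp only [Function.comp_apply, hy₀, sub_self, map_zero]
  abel

end Analysis

/-! ### Regularity of the left-trivialized field -/

section LieGroupChart

variable {E : Type*} [NormedAddCommGroup E] [NormedSpace ℝ E]
  {H : Type*} [TopologicalSpace H] {I : ModelWithCorners ℝ E H}
  {G : Type*} [TopologicalSpace G] [ChartedSpace H G] [Group G]
  {V : Type*} [NormedAddCommGroup V] [NormedSpace ℝ V]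
  {K : Type*} [TopologicalSpace K] {J : ModelWithCorners ℝ V K}
  {U : Type*} [TopologicalSpace U] [ChartedSpace K U]

theorem two_le_infty : (2 : WithTop ℕ∞) ≤ ∞ := WithTop.coe_le_coe.2 (le_top : (2 : ℕ∞) ≤ ⊤)

open Bundle in
-- The left-trivialization is the tangent map of `(x, y) ↦ x⁻¹ y` applied to `(0, F)` over `(g, g)`,
-- and the tangent map of a `C²` map is `C¹`.
theorem contMDiff_leftField [LieGroup I ∞ G] {F : (x : G) → U → TangentSpace I x}
    (hF : ContMDiff (I.prod J) I.tangent 1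
      (fun p : G × U => (⟨p.1, F p.1 p.2⟩ : TangentBundle I G))) :
    ContMDiff (M' := E) (I.prod J) 𝓘(ℝ, E) 1 (fun p : G × U => leftField F p.1 p.2) := by
  have : IsManifold I ∞ G := LieGroup.toContMDiffMul.toIsManifold
  have : IsManifold I 2 G := IsManifold.of_le two_le_infty
  have : IsManifold I 1 G := IsManifold.of_le (n := 2) (by norm_num)
  have : IsManifold I (1 + 1) G := by rwa [one_add_one_eq_two]
  have : ContMDiffVectorBundle 1 E (TangentSpace I : G → Type _) I :=
    TangentBundle.contMDiffVectorBundle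
  have : LieGroup I 2 G := LieGroup.of_le two_le_infty
  let Z : G × U → TangentBundle I G := fun p => TotalSpace.mk' E p.1 0
  have hZ : ContMDiff (I.prod J) I.tangent 1 Z :=
    (contMDiff_zeroSection ℝ (TangentSpace I : G → Type _)).comp contMDiff_fst
  let D : TangentBundle (I.prod I) (G × G) → TangentBundle I G :=
    tangentMap (I.prod I) I (fun p : G × G => p.1⁻¹ * p.2)
  have hψ : ContMDiff (I.prod I) I 2 (fun p : G × G => p.1⁻¹ * p.2) :=
    ((contMDiff_inv I 2).comp contMDiff_fst).mul contMDiff_snd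
  have hD : ContMDiff (I.prod I).tangent I.tangent 1 D :=
    hψ.contMDiff_tangentMap (by norm_num)
  have hS : ContMDiff (I.prod J) I.tangent 1
      (fun p : G × U => D ((equivTangentBundleProd I G I G).symm (Z p, ⟨p.1, F p.1 p.2⟩))) :=
    (hD.comp contMDiff_equivTangentBundleProd_symm).comp (hZ.prodMk hF)
  have hS' : (fun p : G × U => D ((equivTangentBundleProd I G I G).symm (Z p, ⟨p.1, F p.1 p.2⟩)))
      = fun p => (⟨1, leftField F p.1 p.2⟩ : TangentBundle I G) := by
    funext p
    have h1 : p.1⁻¹ * p.1 = 1 := inv_mul_cancel _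
    have h2 : mfderiv (I.prod I) I (fun p : G × G => p.1⁻¹ * p.2) (p.1, p.1)
        ((0 : TangentSpace I p.1), F p.1 p.2) =
        mfderiv I I (fun x : G => p.1⁻¹ * x) p.1 (F p.1 p.2) := by
      refine (mfderiv_prod_eq_add_apply (hψ.mdifferentiableAt (by norm_num))).trans ?_
      exact (congrArg (· + _) (map_zero _)).trans (zero_add _)
    refine Bundle.TotalSpace.ext h1 ?_
    refine HEq.trans ?_ (heq_of_eq h2)
    rfl
  rw [hS'] at hS
  -- All values lie over `1`, where the bundle coordinate is the identity of `E`.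
  intro p
  have hp := (Bundle.contMDiffAt_totalSpace.1 (hS p)).2
  refine hp.congr_of_eventuallyEq (Filter.Eventually.of_forall fun q => ?_)
  exact (tangentCoordChange_self (I := I) (x := (1 : G)) (z := 1)
    (mem_extChartAt_source (1 : G))).symm

/-! ### Multiplication and quotients of curves in the chart around the identity -/

variable (I G) in
/-- The coordinates of the identity in the preferred chart around it. -/
noncomputable def unitPt : E := extChartAt I (1 : G) 1

variable (I G) in
/-- The group multiplication in the preferred chart around the identity. -/
noncomputable def localMul (p : E × E) : E :=
  extChartAt I (1 : G) ((extChartAt I (1 : G)).symm p.1 * (extChartAt I (1 : G)).symm p.2)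

theorem unitPt_mem_target : unitPt I G ∈ (extChartAt I (1 : G)).target := mem_extChartAt_target 1

theorem symm_unitPt : (extChartAt I (1 : G)).symm (unitPt I G) = 1 := extChartAt_to_inv 1

theorem localMul_unitPt_left {y : E} (hy : y ∈ (extChartAt I (1 : G)).target) :
    localMul I G (unitPt I G, y) = y := by
  simp only [localMul, symm_unitPt, one_mul]
  exact (extChartAt I (1 : G)).right_inv hy

theorem localMul_unitPt_right {y : E} (hy : y ∈ (extChartAt I (1 : G)).target) :
    localMul I G (y, unitPt I G) = y := by
  simp only [localMul, symm_unitPt, mul_one]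
  exact (extChartAt I (1 : G)).right_inv hy

theorem hasDerivWithinAt_extChartAt_comp {M : Type*} [TopologicalSpace M]
    [ChartedSpace H M] {k : ℝ → M} {s : Set ℝ} {t : ℝ} {x : M}
    {D : ℝ →L[ℝ] E} (hk : k t = x)
    (h : HasMFDerivWithinAt 𝓘(ℝ, ℝ) I k s t D) :
    HasDerivWithinAt (fun r => extChartAt I x (k r)) (D 1) s t := by
  subst hk
  have h2 : HasFDerivWithinAt (fun r => extChartAt I (k t) (k r)) D s t :=
    h.2.mono (fun r hr => ⟨hr, mem_range_self r⟩)
  exact h2.hasDerivWithinAt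

/-- The field `f(a x, w)` with `x` and `w` read in the charts around `1` and `u`. -/
noncomputable def chartField (J : ModelWithCorners ℝ V K) (F : (x : G) → U → TangentSpace I x)
    (u : U) (a : G) (q : E × V) : E :=
  leftField F (a * (extChartAt I (1 : G)).symm q.1) ((extChartAt J u).symm q.2)

theorem chartField_base (F : (x : G) → U → TangentSpace I x) (u : U) (a : G) :
    chartField J F u a (unitPt I G, extChartAt J u u) = leftField F a u := by
  simp only [chartField, symm_unitPt, mul_one, extChartAt_to_inv]
  rfl

/-- The quotient `g_u⁻¹ g_w` of two members of a family of curves, with `w` and the value read in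
the charts around `u` and `1`. -/
noncomputable def chartQuotient (I : ModelWithCorners ℝ E H) (J : ModelWithCorners ℝ V K)
    (g : U → ℝ → G) (u : U) (w : V) (t : ℝ) : E :=
  extChartAt I (1 : G) ((g u t)⁻¹ * g ((extChartAt J u).symm w) t)

theorem leftVelocity_eq_leftField {P : Type*} {F : (x : G) → P → TangentSpace I x}
    {T : ℝ} (hT : 0 < T)
    {γ : ℝ → G} {u : P} (hγ : IsMIntegralCurveOn γ (fun x => F x u) (Icc 0 T)) {t : ℝ}
    (ht : t ∈ Icc 0 T) : leftVelocity I T γ t = leftField F (γ t) u := by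
  have hu : UniqueMDiffWithinAt 𝓘(ℝ, ℝ) (Icc 0 T) t :=
    (uniqueDiffOn_Icc hT t ht).uniqueMDiffWithinAt
  have h1 : mfderivWithin 𝓘(ℝ, ℝ) I γ (Icc 0 T) t (1 : ℝ) = F (γ t) u :=
    (DFunLike.congr_fun ((hγ t ht).mfderivWithin hu) (1 : ℝ)).trans (one_smul ℝ _)
  exact congrArg (leftTriv (γ t)) h1

/-- The velocity constraint holds along integral curves, so that the augmented cost is the
terminal cost. -/
theorem augmentedCost_eq {P : Type*} {F : (x : G) → P → TangentSpace I x}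
    {C : G → ℝ} {T : ℝ} (hT : 0 < T)
    {γ : ℝ → G} {u : P} (hγ : IsMIntegralCurveOn γ (fun x => F x u) (Icc 0 T))
    (μ : ℝ → (GroupLieAlgebra I G →L[ℝ] ℝ)) : augmentedCost F C T μ γ u = C (γ T) := by
  have h : ∫ t in (0 : ℝ)..T, μ t (leftVelocity I T γ t - leftField F (γ t) u) =
      ∫ t in (0 : ℝ)..T, (0 : ℝ) := by
    refine intervalIntegral.integral_congr fun t ht => ?_
    rw [uIcc_of_le hT.le] at ht
    simp only [leftVelocity_eq_leftField hT hγ ht]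
    rw [sub_self, map_zero]
  rw [augmentedCost, h, intervalIntegral.integral_zero, sub_zero]

/-- Translation by the frozen element `(k t)⁻¹` brings the curve to `1` at time `t`, and there
tangent vectors are by definition read in this very chart. -/
theorem hasDerivWithinAt_leftTriv [LieGroup I ∞ G] {k : ℝ → G} {s : Set ℝ} {t : ℝ}
    {v : TangentSpace I (k t)}
    (h : HasMFDerivWithinAt 𝓘(ℝ, ℝ) I k s t ((1 : ℝ →L[ℝ] ℝ).smulRight v)) :
    HasDerivWithinAt (F := E) (fun r => extChartAt I (1 : G) ((k t)⁻¹ * k r))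
      (leftTriv (k t) v) s t := by
  have hL : HasMFDerivAt I I (fun x : G => (k t)⁻¹ * x) (k t)
      (mfderiv I I (fun x : G => (k t)⁻¹ * x) (k t)) :=
    ((contMDiff_mul_left (I := I) (n := ∞)).mdifferentiableAt (by simp)).hasMFDerivAt
  have h2 := hasDerivWithinAt_extChartAt_comp (k := fun r => (k t)⁻¹ * k r) (x := 1)
    (inv_mul_cancel _) (hL.comp_hasMFDerivWithinAt t h)
  refine h2.congr_deriv ?_
  exact congrArg (mfderiv I I (fun x : G => (k t)⁻¹ * x) (k t)) (one_smul ℝ v)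

variable [I.Boundaryless]

theorem contMDiffAt_extChartAt_symm' [J.Boundaryless] {n : WithTop ℕ∞} [IsManifold J n U]
    {u : U} {y : V} (hy : y ∈ (extChartAt J u).target) :
    ContMDiffAt 𝓘(ℝ, V) J n (extChartAt J u).symm y :=
  (contMDiffOn_extChartAt_symm u).contMDiffAt ((isOpen_extChartAt_target u).mem_nhds hy)

theorem contDiffAt_localMul [LieGroup I ∞ G] {p : E × E}
    (h1 : p.1 ∈ (extChartAt I (1 : G)).target) (h2 : p.2 ∈ (extChartAt I (1 : G)).target)
    (h : (extChartAt I (1 : G)).symm p.1 * (extChartAt I (1 : G)).symm p.2 ∈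
      (extChartAt I (1 : G)).source) :
    ContDiffAt ℝ ∞ (localMul I G) p := by
  have : IsManifold I ∞ G := LieGroup.toContMDiffMul.toIsManifold
  rw [← contMDiffAt_iff_contDiffAt]
  have e1 : ContMDiffAt 𝓘(ℝ, E × E) I ∞
      (fun p : E × E => (extChartAt I (1 : G)).symm p.1) p :=
    (contMDiffAt_extChartAt_symm' h1).comp p contDiff_fst.contMDiff.contMDiffAt
  have e2 : ContMDiffAt 𝓘(ℝ, E × E) I ∞
      (fun p : E × E => (extChartAt I (1 : G)).symm p.2) p :=
    (contMDiffAt_extChartAt_symm' h2).comp p contDiff_snd.contMDiff.contMDiffAt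
  exact (contMDiffAt_extChartAt' (by rwa [extChartAt_source] at h)).comp p (e1.mul e2)

theorem contDiffAt_localMul_unitPt_right [LieGroup I ∞ G] {x : E}
    (hx : x ∈ (extChartAt I (1 : G)).target) : ContDiffAt ℝ ∞ (localMul I G) (x, unitPt I G) :=
  contDiffAt_localMul hx unitPt_mem_target (by
    simpa only [symm_unitPt, mul_one] using (extChartAt I (1 : G)).map_target hx)

theorem contDiffAt_localMul_unitPt_left [LieGroup I ∞ G] {x : E}
    (hx : x ∈ (extChartAt I (1 : G)).target) : ContDiffAt ℝ ∞ (localMul I G) (unitPt I G, x) :=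
  contDiffAt_localMul unitPt_mem_target hx (by
    simpa only [symm_unitPt, one_mul] using (extChartAt I (1 : G)).map_target hx)

theorem fderiv_localMul_unitPt_left [LieGroup I ∞ G] {x : E}
    (hx : x ∈ (extChartAt I (1 : G)).target) (η : E) :
    fderiv ℝ (localMul I G) (unitPt I G, x) (0, η) = η := by
  have hd := ((contDiffAt_localMul_unitPt_left (I := I) (G := G) hx).differentiableAt
    (by simp)).hasFDerivAt
  have h1 : HasFDerivAt (fun y => localMul I G (unitPt I G, y))
      ((fderiv ℝ (localMul I G) (unitPt I G, x)).comp (.inr ℝ E E)) x :=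
    hd.comp _ (hasFDerivAt_prodMk_right _ _)
  have h2 : HasFDerivAt (fun y => localMul I G (unitPt I G, y)) (.id ℝ E) x :=
    (hasFDerivAt_id _).congr_of_eventuallyEq (by
      filter_upwards [(isOpen_extChartAt_target (I := I) (1 : G)).mem_nhds hx] with y hy
      exact localMul_unitPt_left hy)
  exact DFunLike.congr_fun (h1.unique h2) η

/-- The differential of a function at `a`, precomposed with the left translation `𝔤 → T_a G`. -/
noncomputable def leftDeriv {X : Type*} [NormedAddCommGroup X] [NormedSpace ℝ X]
    (I : ModelWithCorners ℝ E H) (f : G → X) (a : G) : E →L[ℝ] X :=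
  (mfderiv I 𝓘(ℝ, X) f a).comp (tangentLeft a)

/-- The differential of a function at `a`, precomposed with the left translation `𝔤 → T_a G`, is
the derivative at the origin of the function read in left-translated coordinates. -/
theorem hasFDerivAt_comp_mul_symm [LieGroup I ∞ G] {X : Type*} [NormedAddCommGroup X]
    [NormedSpace ℝ X] {f : G → X} {a : G} (hf : MDifferentiableAt I 𝓘(ℝ, X) f a) :
    HasFDerivAt (fun x => f (a * (extChartAt I (1 : G)).symm x))
      (leftDeriv I f a) (unitPt I G) := by
  have hL : HasMFDerivAt I I (fun x : G => a * x) 1 (tangentLeft (I := I) a) :=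
    ((contMDiff_mul_left (I := I) (n := ∞) (a := a)).mdifferentiableAt (by simp)).hasMFDerivAt
  have hf' : HasMFDerivAt I 𝓘(ℝ, X) f (a * 1) (mfderiv I 𝓘(ℝ, X) f a) := by
    rw [mul_one]; exact hf.hasMFDerivAt
  have h := (hf'.comp (1 : G) hL).2
  rw [I.range_eq_univ] at h
  exact hasFDerivWithinAt_univ.1 h

/-- The equation satisfied by a quotient `γ⁻¹ k` of two curves in the chart around the identity. -/
theorem hasDerivWithinAt_quotient [LieGroup I ∞ G] {γ k : ℝ → G} {s : Set ℝ} {t : ℝ}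
    (hs : UniqueDiffWithinAt ℝ s t) (hts : t ∈ s)
    {v : TangentSpace I (γ t)} {w : TangentSpace I (k t)}
    (hγ : HasMFDerivWithinAt 𝓘(ℝ, ℝ) I γ s t ((1 : ℝ →L[ℝ] ℝ).smulRight v))
    (hk : HasMFDerivWithinAt 𝓘(ℝ, ℝ) I k s t ((1 : ℝ →L[ℝ] ℝ).smulRight w))
    (hx : (γ t)⁻¹ * k t ∈ (extChartAt I (1 : G)).source) :
    HasDerivWithinAt (fun r => extChartAt I (1 : G) ((γ r)⁻¹ * k r))
      (fderiv ℝ (localMul I G) (extChartAt I (1 : G) ((γ t)⁻¹ * k t), unitPt I G)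
          (0, leftTriv (k t) w) -
        fderiv ℝ (localMul I G) (unitPt I G, extChartAt I (1 : G) ((γ t)⁻¹ * k t))
          (leftTriv (γ t) v, 0)) s t := by
  have : IsManifold I ∞ G := LieGroup.toContMDiffMul.toIsManifold
  have : IsManifold I 1 G := IsManifold.of_le (n := ∞) (by simp)
  have : LieGroup I 1 G := LieGroup.of_le (n := ∞) (by simp)
  have hcont : ContinuousMul G := continuousMul_of_contMDiffMul I ∞
  have hcinv : ContinuousInv G := (topologicalGroup_of_lieGroup I ∞).toContinuousInv
  set x := extChartAt I (1 : G) ((γ t)⁻¹ * k t) with hxdef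
  have hxt : x ∈ (extChartAt I (1 : G)).target := (extChartAt I (1 : G)).map_source hx
  have hα := hasDerivWithinAt_leftTriv hγ
  have hb := hasDerivWithinAt_leftTriv hk
  have hyd : DifferentiableWithinAt ℝ (fun r => extChartAt I (1 : G) ((γ r)⁻¹ * k r)) s t := by
    have h1 : MDifferentiableWithinAt 𝓘(ℝ, ℝ) I (fun r => (γ r)⁻¹ * k r) s t := by
      have hq : MDifferentiableAt (I.prod I) I (fun p : G × G => p.1⁻¹ * p.2) (γ t, k t) :=
        (((contMDiff_inv I ∞).comp contMDiff_fst).mul contMDiff_snd).mdifferentiableAt (by simp)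
      exact hq.comp_mdifferentiableWithinAt t
        (hγ.mdifferentiableWithinAt.prodMk hk.mdifferentiableWithinAt)
    have h2 := (mdifferentiableAt_extChartAt (I := I) (x := (1 : G))
      (y := (γ t)⁻¹ * k t) (by rwa [extChartAt_source] at hx)).comp_mdifferentiableWithinAt t h1
    exact mdifferentiableWithinAt_iff_differentiableWithinAt.1 h2
  -- Smoothness of the group operations only gives existence of `y'`; its value comes from the
  -- identity below.
  obtain ⟨y', hy'⟩ : ∃ y', HasDerivWithinAt (fun r => extChartAt I (1 : G) ((γ r)⁻¹ * k r)) y' s t :=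
    ⟨_, hyd.hasDerivWithinAt⟩
  have hγc : ContinuousWithinAt γ s t := hγ.1
  have hkc : ContinuousWithinAt k s t := hk.1
  have hS : IsOpen (extChartAt I (1 : G)).source := isOpen_extChartAt_source 1
  have h1S : (1 : G) ∈ (extChartAt I (1 : G)).source := mem_extChartAt_source 1
  have hγ1 : ContinuousWithinAt (fun r => (γ t)⁻¹ * γ r) s t := continuousWithinAt_const.mul hγc
  have hk1 : ContinuousWithinAt (fun r => (k t)⁻¹ * k r) s t := continuousWithinAt_const.mul hkc
  have hγk : ContinuousWithinAt (fun r => (γ r)⁻¹ * k r) s t := hγc.inv.mul hkc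
  -- This is `(γ t)⁻¹ γ r · (γ r)⁻¹ k r = (γ t)⁻¹ k t · (k t)⁻¹ k r` in coordinates. Differentiating
  -- both sides at `t` avoids differentiating the inversion; `D₂m(e, x) = id` isolates `y'`.
  have hev : (fun r => localMul I G (extChartAt I (1 : G) ((γ t)⁻¹ * γ r),
        extChartAt I (1 : G) ((γ r)⁻¹ * k r))) =ᶠ[𝓝[s] t]
      fun r => localMul I G (x, extChartAt I (1 : G) ((k t)⁻¹ * k r)) := by
    filter_upwards [hγ1.preimage_mem_nhdsWithin (hS.mem_nhds (by rwa [inv_mul_cancel])),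
      hk1.preimage_mem_nhdsWithin (hS.mem_nhds (by rwa [inv_mul_cancel])),
      hγk.preimage_mem_nhdsWithin (hS.mem_nhds hx)] with r h1 h2 h3
    simp only [localMul, hxdef]
    rw [(extChartAt I (1 : G)).left_inv h1, (extChartAt I (1 : G)).left_inv h2,
      (extChartAt I (1 : G)).left_inv h3, (extChartAt I (1 : G)).left_inv hx]
    congr 1
    group
  have hlhs := ((contDiffAt_localMul_unitPt_left (I := I) (G := G) hxt).differentiableAt
    (by simp)).hasFDerivAt.comp_hasDerivWithinAt_of_eq t (hα.prodMk hy') (by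
      simp [hxdef, unitPt])
  have hrhs := ((contDiffAt_localMul_unitPt_right (I := I) (G := G) hxt).differentiableAt
    (by simp)).hasFDerivAt.comp_hasDerivWithinAt_of_eq t
      ((hasDerivWithinAt_const t s x).prodMk hb) (by simp [unitPt])
  have huniq := hs.eq_deriv _ hlhs (hrhs.congr_of_eventuallyEq hev (hev.self_of_nhdsWithin hts))
  have hsplit : ∀ a : E, fderiv ℝ (localMul I G) (unitPt I G, x) (a, y') =
      fderiv ℝ (localMul I G) (unitPt I G, x) (a, 0) + y' := fun a => by
    conv_rhs => rw [← fderiv_localMul_unitPt_left hxt y', ← map_add, Prod.mk_add_mk, zero_add,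
      add_zero]
  exact hy'.congr_deriv (eq_sub_of_add_eq' ((hsplit _).symm.trans huniq))

/-! ### The Lie bracket as a second derivative of the multiplication -/

theorem hasFDerivAt_fderiv_localMul [LieGroup I ∞ G] :
    HasFDerivAt (fderiv ℝ (localMul I G))
      (fderiv ℝ (fderiv ℝ (localMul I G)) (unitPt I G, unitPt I G)) (unitPt I G, unitPt I G) :=
  (((contDiffAt_localMul_unitPt_left (I := I) (G := G) unitPt_mem_target).fderiv_right
    (m := 1) (by exact_mod_cast two_le_infty)).differentiableAt (by simp)).hasFDerivAt

/-- The derivative of `x ↦ T L_x η` in the chart around the identity. -/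
theorem hasFDerivAt_fderiv_localMul_inr [LieGroup I ∞ G] (η : E) :
    HasFDerivAt (fun x => fderiv ℝ (localMul I G) (x, unitPt I G) (0, η))
      (((fderiv ℝ (fderiv ℝ (localMul I G)) (unitPt I G, unitPt I G)).flip (0, η)).comp
        (.inl ℝ E E)) (unitPt I G) := by
  have h := (hasFDerivAt_fderiv_localMul (I := I) (G := G)).comp (unitPt I G)
    (f := fun x => (x, unitPt I G)) (hasFDerivAt_prodMk_left (unitPt I G) (unitPt I G))
  exact (ContinuousLinearMap.apply ℝ E ((0, η) : E × E)).hasFDerivAt.comp _ h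

theorem mfderiv_extChartAt_one [LieGroup I ∞ G] (v : E) :
    mfderiv I 𝓘(ℝ, E) (extChartAt I (1 : G)) 1 v = v := by
  have : IsManifold I ∞ G := LieGroup.toContMDiffMul.toIsManifold
  have : IsManifold I 1 G := IsManifold.of_le (n := ∞) (by simp)
  have h1 : HasMFDerivAt I 𝓘(ℝ, E) (extChartAt I (1 : G)) 1 (.id ℝ E) := by
    refine ⟨continuousAt_extChartAt 1, ?_⟩
    refine (hasFDerivWithinAt_id _ _).congr_of_eventuallyEq ?_ ?_
    · filter_upwards [mem_nhdsWithin_of_mem_nhds (extChartAt_target_mem_nhds (I := I) (1 : G))]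
        with y hy
      exact (extChartAt I (1 : G)).right_inv hy
    · exact (extChartAt I (1 : G)).right_inv unitPt_mem_target
  exact DFunLike.congr_fun h1.mfderiv v

/-- A left-invariant vector field in the chart around the identity. -/
theorem mpullbackWithin_mulInvariantVectorField [LieGroup I ∞ G] (η : E) {y : E}
    (hy : y ∈ (extChartAt I (1 : G)).target) :
    @Eq E (VectorField.mpullbackWithin 𝓘(ℝ, E) I (extChartAt I (1 : G)).symm
      (mulInvariantVectorField η) (range I) y)
    (fderiv ℝ (localMul I G) (y, unitPt I G) (0, η)) := by
  have : IsManifold I ∞ G := LieGroup.toContMDiffMul.toIsManifold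
  have : IsManifold I 1 G := IsManifold.of_le (n := ∞) (by simp)
  have hs : (extChartAt I (1 : G)).symm y ∈ (extChartAt I (1 : G)).source :=
    (extChartAt I (1 : G)).map_target hy
  have hinv : (mfderivWithin 𝓘(ℝ, E) I (extChartAt I (1 : G)).symm (range I) y).inverse =
      mfderiv I 𝓘(ℝ, E) (extChartAt I (1 : G)) ((extChartAt I (1 : G)).symm y) :=
    ContinuousLinearMap.inverse_eq (mfderivWithin_extChartAt_symm_comp_mfderiv_extChartAt hy)
      (mfderiv_extChartAt_comp_mfderivWithin_extChartAt_symm hy)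
  have h1 := hasFDerivAt_comp_mul_symm (mdifferentiableAt_extChartAt (I := I) (x := (1 : G))
    (y := (extChartAt I (1 : G)).symm y) (by rwa [extChartAt_source] at hs))
  have h2 := ((contDiffAt_localMul_unitPt_right (I := I) (G := G) hy).differentiableAt
    (by simp)).hasFDerivAt.comp (unitPt I G) (f := fun x => (y, x))
      (hasFDerivAt_prodMk_right y (unitPt I G))
  have h3 := DFunLike.congr_fun (h1.unique h2) η
  exact (DFunLike.congr_fun hinv _).trans h3

/-- The Lie bracket in terms of the second derivative of the local multiplication. -/
theorem bracket_eq_fderiv_fderiv_localMul [LieGroup I ∞ G] (ξ η : E) :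
    @Eq E (Bracket.bracket (L := GroupLieAlgebra I G) (M := GroupLieAlgebra I G) ξ η)
      (fderiv ℝ (fderiv ℝ (localMul I G)) (unitPt I G, unitPt I G) (ξ, 0) (0, η) -
        fderiv ℝ (fderiv ℝ (localMul I G)) (unitPt I G, unitPt I G) (η, 0) (0, ξ)) := by
  -- In the chart the left-invariant field of `ζ` is `y ↦ D₂m(y, e) ζ`: its value at `e` is `ζ` and
  -- its derivative there is a mixed second derivative of `m`.
  let X : E → E → E := fun ζ => VectorField.mpullbackWithin 𝓘(ℝ, E) I
    (extChartAt I (1 : G)).symm (mulInvariantVectorField (I := I) (G := G) ζ) (range I)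
  have key : ∀ ζ : E, HasFDerivWithinAt (X ζ)
      (((fderiv ℝ (fderiv ℝ (localMul I G)) (unitPt I G, unitPt I G)).flip (0, ζ)).comp
        (.inl ℝ E E)) univ (unitPt I G) := fun ζ => by
    refine ((hasFDerivAt_fderiv_localMul_inr (I := I) (G := G) ζ).congr_of_eventuallyEq
      ?_).hasFDerivWithinAt
    filter_upwards [extChartAt_target_mem_nhds (I := I) (1 : G)] with y hy
    exact mpullbackWithin_mulInvariantVectorField ζ hy
  have hval : ∀ ζ : E, X ζ (unitPt I G) = ζ := fun ζ =>
    (mpullbackWithin_mulInvariantVectorField ζ unitPt_mem_target).trans (fderiv_localMul_unitPt_left unitPt_mem_target _)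
  have hset : (extChartAt I (1 : G)).symm ⁻¹' univ ∩ range I = univ := by
    rw [preimage_univ, I.range_eq_univ, univ_inter]
  -- The bracket computed in `E` is carried back by the inverse of this derivative, which changes
  -- nothing.
  have hid : mfderiv I 𝓘(ℝ, E) (extChartAt I (1 : G)) 1 = ContinuousLinearMap.id ℝ E :=
    ContinuousLinearMap.ext fun v => mfderiv_extChartAt_one (E := E) v
  have hidinv : (mfderiv I 𝓘(ℝ, E) (extChartAt I (1 : G)) 1).inverse =
      ContinuousLinearMap.id ℝ E :=
    (congrArg (ContinuousLinearMap.inverse (R := ℝ) (M := E) (M₂ := E)) hid).trans ContinuousLinearMap.inverse_id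
  have hL : VectorField.lieBracketWithin ℝ (X ξ) (X η) univ (unitPt I G) =
      fderiv ℝ (fderiv ℝ (localMul I G)) (unitPt I G, unitPt I G) (ξ, 0) (0, η) -
        fderiv ℝ (fderiv ℝ (localMul I G)) (unitPt I G, unitPt I G) (η, 0) (0, ξ) := by
    rw [VectorField.lieBracketWithin, (key η).fderivWithin uniqueDiffWithinAt_univ,
      (key ξ).fderivWithin uniqueDiffWithinAt_univ, hval, hval]
    rfl
  rw [← hset] at hL
  exact (DFunLike.congr_fun hidinv _).trans hL

theorem fderiv_fderiv_localMul_symm [LieGroup I ∞ G] (v w : E × E) :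
    fderiv ℝ (fderiv ℝ (localMul I G)) (unitPt I G, unitPt I G) v w =
      fderiv ℝ (fderiv ℝ (localMul I G)) (unitPt I G, unitPt I G) w v :=
  (contDiffAt_localMul_unitPt_left (I := I) (G := G) unitPt_mem_target).isSymmSndFDerivAt
    (by simpa using two_le_infty) v w

theorem fderiv_localMul_inl [LieGroup I ∞ G] (η : E) :
    fderiv ℝ (localMul I G) (unitPt I G, unitPt I G) (η, 0) = η := by
  have hd := ((contDiffAt_localMul_unitPt_right (I := I) (G := G) unitPt_mem_target).differentiableAt
    (by simp)).hasFDerivAt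
  have h1 : HasFDerivAt (fun y => localMul I G (y, unitPt I G))
      ((fderiv ℝ (localMul I G) (unitPt I G, unitPt I G)).comp (.inl ℝ E E)) (unitPt I G) :=
    hd.comp (unitPt I G) (f := fun y => (y, unitPt I G)) (hasFDerivAt_prodMk_left _ _)
  have h2 : HasFDerivAt (fun y => localMul I G (y, unitPt I G)) (.id ℝ E) (unitPt I G) :=
    (hasFDerivAt_id _).congr_of_eventuallyEq (by
      filter_upwards [extChartAt_target_mem_nhds (I := I) (1 : G)] with y hy
      exact localMul_unitPt_right hy)
  exact DFunLike.congr_fun (h1.unique h2) η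

/-! ### The quotient equation and its linearization -/

/-- The vector field, in the charts around `1` and `u`, that governs the quotient `g_u⁻¹ g_w` of two
integral curves, when `g_u` is at `a`. -/
noncomputable def quotientField (J : ModelWithCorners ℝ V K) (F : (x : G) → U → TangentSpace I x)
    (u : U) (a : G) (q : E × V) : E :=
  fderiv ℝ (localMul I G) (q.1, unitPt I G) (0, chartField J F u a q) -
    fderiv ℝ (localMul I G) (unitPt I G, q.1) (chartField J F u a (unitPt I G, extChartAt J u u), 0)

theorem quotientField_base [LieGroup I ∞ G] (F : (x : G) → U → TangentSpace I x) (u : U) (a : G) :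
    quotientField J F u a (unitPt I G, extChartAt J u u) = 0 := by
  simp only [quotientField, fderiv_localMul_inl, fderiv_localMul_unitPt_left unitPt_mem_target, sub_self]

theorem hasDerivWithinAt_chartQuotient [LieGroup I ∞ G] {F : (x : G) → U → TangentSpace I x}
    {T : ℝ} (hT : 0 < T) {g : U → ℝ → G}
    (hg : ∀ u, IsMIntegralCurveOn (g u) (fun x => F x u) (Icc 0 T)) (u : U) {w : V} {t : ℝ}
    (ht : t ∈ Icc 0 T)
    (hx : (g u t)⁻¹ * g ((extChartAt J u).symm w) t ∈ (extChartAt I (1 : G)).source) :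
    HasDerivWithinAt (chartQuotient I J g u w)
      (quotientField J F u (g u t) (chartQuotient I J g u w t, w)) (Icc 0 T) t := by
  have h := hasDerivWithinAt_quotient (uniqueDiffOn_Icc hT t ht) ht (hg u t ht)
    (hg ((extChartAt J u).symm w) t ht) hx
  have h1 : chartField J F u (g u t) (chartQuotient I J g u w t, w) =
      leftField F (g ((extChartAt J u).symm w) t) ((extChartAt J u).symm w) := by
    simp only [chartField, chartQuotient]
    rw [(extChartAt I (1 : G)).left_inv hx, mul_inv_cancel_left]
  refine h.congr_deriv ?_
  rw [quotientField, h1, chartField_base]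
  rfl

variable [J.Boundaryless] [IsManifold J 1 U]

/-- The base point also needs a coordinate, because estimates uniform along the curve require joint
regularity in base point and `q`; it is written as `a` times a point near `1`. -/
theorem contDiffAt_chartField [LieGroup I ∞ G] {F : (x : G) → U → TangentSpace I x}
    (hF : ContMDiff (I.prod J) I.tangent 1
      (fun p : G × U => (⟨p.1, F p.1 p.2⟩ : TangentBundle I G))) (u : U) (a : G) :
    ContDiffAt ℝ 1 (fun p : E × (E × V) =>
      chartField J F u (a * (extChartAt I (1 : G)).symm p.1) p.2)
      (unitPt I G, (unitPt I G, extChartAt J u u)) := by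
  have : IsManifold I ∞ G := LieGroup.toContMDiffMul.toIsManifold
  have : IsManifold I 1 G := IsManifold.of_le (n := ∞) (by simp)
  have : LieGroup I 1 G := LieGroup.of_le (n := ∞) (by simp)
  rw [← contMDiffAt_iff_contDiffAt]
  have e1 : ContMDiffAt 𝓘(ℝ, E × (E × V)) I 1
      (fun p : E × (E × V) => (extChartAt I (1 : G)).symm p.1)
      (unitPt I G, (unitPt I G, extChartAt J u u)) :=
    (contMDiffAt_extChartAt_symm' unitPt_mem_target).comp
      (unitPt I G, (unitPt I G, extChartAt J u u)) contDiff_fst.contMDiff.contMDiffAt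
  have e2 : ContMDiffAt 𝓘(ℝ, E × (E × V)) I 1
      (fun p : E × (E × V) => (extChartAt I (1 : G)).symm p.2.1)
      (unitPt I G, (unitPt I G, extChartAt J u u)) :=
    (contMDiffAt_extChartAt_symm' unitPt_mem_target).comp
      (unitPt I G, (unitPt I G, extChartAt J u u))
      (contDiff_fst.comp contDiff_snd).contMDiff.contMDiffAt
  have e3 : ContMDiffAt 𝓘(ℝ, E × (E × V)) J 1
      (fun p : E × (E × V) => (extChartAt J u).symm p.2.2)
      (unitPt I G, (unitPt I G, extChartAt J u u)) :=
    (contMDiffAt_extChartAt_symm' (mem_extChartAt_target u)).comp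
      (unitPt I G, (unitPt I G, extChartAt J u u))
      (contDiff_snd.comp contDiff_snd).contMDiff.contMDiffAt
  exact ((contMDiff_leftField hF).contMDiffAt).comp
    (unitPt I G, (unitPt I G, extChartAt J u u))
    (((contMDiffAt_const.mul e1).mul e2).prodMk e3)

theorem contDiffAt_quotientField [LieGroup I ∞ G] {F : (x : G) → U → TangentSpace I x}
    (hF : ContMDiff (I.prod J) I.tangent 1
      (fun p : G × U => (⟨p.1, F p.1 p.2⟩ : TangentBundle I G))) (u : U) (a : G) :
    ContDiffAt ℝ 1 (fun p : E × (E × V) =>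
      quotientField J F u (a * (extChartAt I (1 : G)).symm p.1) p.2)
      (unitPt I G, (unitPt I G, extChartAt J u u)) := by
  have hm : ContDiffAt ℝ 1 (fderiv ℝ (localMul I G)) (unitPt I G, unitPt I G) :=
    (contDiffAt_localMul_unitPt_left (I := I) (G := G) unitPt_mem_target).fderiv_right
      (by exact_mod_cast two_le_infty)
  have hc := contDiffAt_chartField hF u a
  have hc0 : ContDiffAt ℝ 1 (fun p : E × (E × V) =>
      chartField J F u (a * (extChartAt I (1 : G)).symm p.1) (unitPt I G, extChartAt J u u))
      (unitPt I G, (unitPt I G, extChartAt J u u)) :=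
    ContDiffAt.comp (f := fun p : E × (E × V) =>
        (p.1, ((unitPt I G, extChartAt J u u) : E × V)))
      (unitPt I G, (unitPt I G, extChartAt J u u)) hc (contDiffAt_fst.prodMk contDiffAt_const)
  have h1 : ContDiffAt ℝ 1 (fun p : E × (E × V) =>
      fderiv ℝ (localMul I G) (p.2.1, unitPt I G))
      (unitPt I G, (unitPt I G, extChartAt J u u)) :=
    ContDiffAt.comp (f := fun p : E × (E × V) => (p.2.1, unitPt I G)) _ hm (by fun_prop)
  have h2 : ContDiffAt ℝ 1 (fun p : E × (E × V) =>
      fderiv ℝ (localMul I G) (unitPt I G, p.2.1))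
      (unitPt I G, (unitPt I G, extChartAt J u u)) :=
    ContDiffAt.comp (f := fun p : E × (E × V) => (unitPt I G, p.2.1)) _ hm (by fun_prop)
  exact (h1.clm_apply (contDiffAt_const.prodMk hc)).sub
    (h2.clm_apply (hc0.prodMk contDiffAt_const))

/-- The linearization of `quotientField` at the base point. -/
noncomputable def quotientDeriv (J : ModelWithCorners ℝ V K) (F : (x : G) → U → TangentSpace I x)
    (u : U) (a : G) : E × V →L[ℝ] E :=
  fderiv ℝ (quotientField J F u a) (unitPt I G, extChartAt J u u)

/-- `eventually_norm_sub_fderiv_right_le` with the coordinate of `a⁻¹ b` as the additional variable,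
transported back to base points `b` near `a`. -/
theorem quotientField_expansion [LieGroup I ∞ G] {F : (x : G) → U → TangentSpace I x}
    (hF : ContMDiff (I.prod J) I.tangent 1
      (fun p : G × U => (⟨p.1, F p.1 p.2⟩ : TangentBundle I G))) (u : U) (a : G) :
    ContinuousAt (quotientDeriv J F u) a ∧
    ∀ ε > 0, ∀ᶠ p in 𝓝 (a, ((unitPt I G, extChartAt J u u) : E × V)),
      ‖quotientField J F u p.1 p.2 - quotientDeriv J F u p.1 (p.2 - (unitPt I G, extChartAt J u u))‖
        ≤ ε * ‖p.2 - (unitPt I G, extChartAt J u u)‖ := by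
  have : ContinuousMul G := continuousMul_of_contMDiffMul I ∞
  obtain ⟨h1, h2⟩ := eventually_norm_sub_fderiv_right_le (contDiffAt_quotientField hF u a)
    (fun z => quotientField_base F u _)
  have hz : ContinuousAt (fun b => extChartAt I (1 : G) (a⁻¹ * b)) a := by
    refine ContinuousAt.comp (g := extChartAt I (1 : G)) (f := fun b => a⁻¹ * b) ?_ (by fun_prop)
    rw [inv_mul_cancel]
    exact continuousAt_extChartAt 1
  have hza : extChartAt I (1 : G) (a⁻¹ * a) = unitPt I G := by rw [inv_mul_cancel]; rfl
  have hb : ∀ᶠ b in 𝓝 a, a * (extChartAt I (1 : G)).symm (extChartAt I (1 : G) (a⁻¹ * b)) = b := by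
    have hc : ContinuousAt (fun b => a⁻¹ * b) a := by fun_prop
    filter_upwards [hc.preimage_mem_nhds ((isOpen_extChartAt_source (I := I) (1 : G)).mem_nhds
      (by simpa only [inv_mul_cancel] using mem_extChartAt_source (1 : G)))] with b hb
    rw [(extChartAt I (1 : G)).left_inv hb, mul_inv_cancel_left]
  constructor
  · refine (ContinuousAt.comp_of_eq (f := fun b => extChartAt I (1 : G) (a⁻¹ * b)) h1 hz hza).congr ?_
    filter_upwards [hb] with b hb
    simp only [Function.comp_apply, hb]
    rfl
  · intro ε hε
    have ht : Filter.Tendsto (fun p : G × (E × V) => (extChartAt I (1 : G) (a⁻¹ * p.1), p.2))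
        (𝓝 (a, (unitPt I G, extChartAt J u u))) (𝓝 (unitPt I G, (unitPt I G, extChartAt J u u))) := by
      have hz' : Filter.Tendsto (fun b => extChartAt I (1 : G) (a⁻¹ * b)) (𝓝 a)
          (𝓝 (unitPt I G)) := by
        rw [← hza]; exact hz
      exact (hz'.comp (continuous_fst.tendsto
        (a, ((unitPt I G, extChartAt J u u) : E × V)))).prodMk_nhds
        (continuous_snd.tendsto _)
    filter_upwards [ht.eventually (h2 ε hε), continuousAt_fst.eventually hb] with p hp hb
    simp only [hb] at hp
    exact hp

theorem differentiableAt_chartField [LieGroup I ∞ G] {F : (x : G) → U → TangentSpace I x}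
    (hF : ContMDiff (I.prod J) I.tangent 1
      (fun p : G × U => (⟨p.1, F p.1 p.2⟩ : TangentBundle I G))) (u : U) (a : G) :
    DifferentiableAt ℝ (chartField J F u a) (unitPt I G, extChartAt J u u) := by
  have h := (contDiffAt_chartField hF u a).differentiableAt (by simp)
  have h2 := DifferentiableAt.comp (f := fun q : E × V => (unitPt I G, q))
    (unitPt I G, extChartAt J u u) h (by fun_prop)
  simpa only [Function.comp_def, symm_unitPt, mul_one] using h2

theorem quotientDeriv_apply [LieGroup I ∞ G] {F : (x : G) → U → TangentSpace I x}
    (hF : ContMDiff (I.prod J) I.tangent 1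
      (fun p : G × U => (⟨p.1, F p.1 p.2⟩ : TangentBundle I G))) (u : U) (a : G) {ξ : E}
    (hξ : leftField F a u = ξ) (δ : E) (v : V) :
    quotientDeriv J F u a (δ, v) =
      fderiv ℝ (fderiv ℝ (localMul I G)) (unitPt I G, unitPt I G) (δ, 0) (0, ξ) +
      fderiv ℝ (chartField J F u a) (unitPt I G, extChartAt J u u) (δ, v) -
      fderiv ℝ (fderiv ℝ (localMul I G)) (unitPt I G, unitPt I G) (0, δ) (ξ, 0) := by
  have hb : chartField J F u a (unitPt I G, extChartAt J u u) = ξ :=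
    (chartField_base F u a).trans hξ
  have hc := (differentiableAt_chartField hF u a).hasFDerivAt
  have h1 : HasFDerivAt (fun q : E × V => fderiv ℝ (localMul I G) (q.1, unitPt I G))
      ((fderiv ℝ (fderiv ℝ (localMul I G)) (unitPt I G, unitPt I G)).comp
        ((ContinuousLinearMap.fst ℝ E V).prod 0)) (unitPt I G, extChartAt J u u) :=
    (hasFDerivAt_fderiv_localMul (I := I) (G := G)).comp
      (unitPt I G, extChartAt J u u) (f := fun q : E × V => (q.1, unitPt I G))
      (hasFDerivAt_fst.prodMk (hasFDerivAt_const _ _))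
  have h2 : HasFDerivAt (fun q : E × V => fderiv ℝ (localMul I G) (unitPt I G, q.1))
      ((fderiv ℝ (fderiv ℝ (localMul I G)) (unitPt I G, unitPt I G)).comp
        ((0 : E × V →L[ℝ] E).prod (ContinuousLinearMap.fst ℝ E V)))
      (unitPt I G, extChartAt J u u) :=
    (hasFDerivAt_fderiv_localMul (I := I) (G := G)).comp
      (unitPt I G, extChartAt J u u) (f := fun q : E × V => (unitPt I G, q.1))
      ((hasFDerivAt_const _ _).prodMk hasFDerivAt_fst)
  have h3 : HasFDerivAt (fun q : E × V => ((0 : E), chartField J F u a q))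
      ((0 : E × V →L[ℝ] E).prod (fderiv ℝ (chartField J F u a) (unitPt I G, extChartAt J u u)))
      (unitPt I G, extChartAt J u u) := (hasFDerivAt_const _ _).prodMk hc
  have h4 := (h1.clm_apply h3).sub (h2.clm_apply (hasFDerivAt_const
    ((ξ, 0) : E × E)
    ((unitPt I G, extChartAt J u u) : E × V)))
  have h5 : quotientDeriv J F u a = _ := (h4.congr_of_eventuallyEq
    (Filter.Eventually.of_forall fun q => by simp only [quotientField, hb]; rfl)).fderiv
  rw [h5]
  simp only [hb]
  have h6 := fderiv_localMul_unitPt_left (I := I) (G := G) unitPt_mem_target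
    (fderiv ℝ (chartField J F u a) (unitPt I G, extChartAt J u u) (δ, v))
  simp only [sub_apply, add_apply, ContinuousLinearMap.comp_apply, ContinuousLinearMap.prod_apply,
    ContinuousLinearMap.flip_apply, zero_apply, ContinuousLinearMap.coe_fst', map_zero, h6]
  abel

/-- Source of the `ad^*` term: the mixed second derivatives from the two summands of `quotientField`
combine, by symmetry of the second derivative, to `-[ξ, δ]`. -/
theorem quotientDeriv_inl [LieGroup I ∞ G] {F : (x : G) → U → TangentSpace I x}
    (hF : ContMDiff (I.prod J) I.tangent 1
      (fun p : G × U => (⟨p.1, F p.1 p.2⟩ : TangentBundle I G))) (u : U) (a : G) (δ : E) :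
    quotientDeriv J F u a (δ, 0) = @HSub.hSub E E E _ (leftFieldDg F a u (tangentLeft a δ))
      (Bracket.bracket (L := GroupLieAlgebra I G) (M := GroupLieAlgebra I G)
        (leftField F a u) δ) := by
  have hf : MDifferentiableAt (M' := E) I 𝓘(ℝ, E) (fun y => leftField F y u) a :=
    ((contMDiff_leftField hF).comp (contMDiff_id.prodMk contMDiff_const)).mdifferentiableAt (by simp)
  have h1 := (differentiableAt_chartField hF u a).hasFDerivAt.comp (unitPt I G)
    (f := fun x => (x, extChartAt J u u)) (hasFDerivAt_prodMk_left _ _)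
  have h2 := hasFDerivAt_comp_mul_symm hf
  have h3 : (chartField J F u a ∘ fun x => (x, extChartAt J u u)) =
      fun x => (leftField F (a * (extChartAt I (1 : G)).symm x) u : E) := by
    funext x
    simp only [Function.comp_apply, chartField, extChartAt_to_inv]
    rfl
  rw [h3] at h1
  have h4 : fderiv ℝ (chartField J F u a) (unitPt I G, extChartAt J u u) (δ, 0) =
      leftFieldDg F a u (tangentLeft a δ) := DFunLike.congr_fun (h1.unique h2) δ
  have h5 := bracket_eq_fderiv_fderiv_localMul (I := I) (G := G) (leftField F a u) δ
  rw [quotientDeriv_apply hF u a rfl]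
  refine Eq.trans ?_ (congrArg₂ (fun x y : E => x - y) h4 h5.symm)
  rw [fderiv_fderiv_localMul_symm (0, δ)]
  abel

theorem quotientDeriv_inr [LieGroup I ∞ G] {F : (x : G) → U → TangentSpace I x}
    (hF : ContMDiff (I.prod J) I.tangent 1
      (fun p : G × U => (⟨p.1, F p.1 p.2⟩ : TangentBundle I G))) (u : U) (a : G) (v : V) :
    quotientDeriv J F u a (0, v) = leftFieldDu J F a u v := by
  have hf : MDifferentiableAt (M' := E) J 𝓘(ℝ, E) (fun w => leftField F a w) u :=
    ((contMDiff_leftField hF).comp (contMDiff_const.prodMk contMDiff_id)).mdifferentiableAt (by simp)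
  have h1 := (differentiableAt_chartField hF u a).hasFDerivAt.comp (extChartAt J u u)
    (f := fun w => (unitPt I G, w)) (hasFDerivAt_prodMk_right _ _)
  have h2 : HasFDerivAt (fun w => (leftField F a ((extChartAt J u).symm w) : E))
      (leftFieldDu J F a u : V →L[ℝ] E) (extChartAt J u u) := by
    have := hf.hasMFDerivAt.2
    rw [J.range_eq_univ] at this
    exact hasFDerivWithinAt_univ.1 this
  have h3 : (chartField J F u a ∘ fun w => (unitPt I G, w)) =
      fun w => (leftField F a ((extChartAt J u).symm w) : E) := by
    funext x
    simp only [Function.comp_apply, chartField, symm_unitPt, mul_one]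
    rfl
  rw [h3] at h1
  have h4 : fderiv ℝ (chartField J F u a) (unitPt I G, extChartAt J u u) (0, v) =
      leftFieldDu J F a u v := DFunLike.congr_fun (h1.unique h2) v
  rw [quotientDeriv_apply hF u a rfl, Prod.mk_zero_zero, map_zero, zero_apply, zero_apply,
    zero_add, sub_zero]
  exact h4

/-- The expansion is locally uniform in the base point, and the curve has compact image. -/
theorem quotientField_uniform_expansion [LieGroup I ∞ G] {F : (x : G) → U → TangentSpace I x}
    (hF : ContMDiff (I.prod J) I.tangent 1
      (fun p : G × U => (⟨p.1, F p.1 p.2⟩ : TangentBundle I G))) (u : U)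
    {γ : ℝ → G} {s : Set ℝ} (hs : IsCompact s) (hγ : ContinuousOn γ s) {ε : ℝ} (hε : 0 < ε) :
    ∀ᶠ q in 𝓝 ((unitPt I G, extChartAt J u u) : E × V), ∀ t ∈ s,
      ‖quotientField J F u (γ t) q - quotientDeriv J F u (γ t) (q - (unitPt I G, extChartAt J u u))‖
        ≤ ε * ‖q - (unitPt I G, extChartAt J u u)‖ := by
  have h := (hs.image_of_continuousOn hγ).eventually_forall_of_forall_eventually
    (x₀ := ((unitPt I G, extChartAt J u u) : E × V))
    (P := fun q a => ‖quotientField J F u a q -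
      quotientDeriv J F u a (q - (unitPt I G, extChartAt J u u))‖ ≤
        ε * ‖q - (unitPt I G, extChartAt J u u)‖) (fun a _ =>
      (continuous_swap.tendsto ((unitPt I G, extChartAt J u u), a)).eventually
        ((quotientField_expansion hF u a).2 ε hε))
  filter_upwards [h] with q hq t ht
  exact hq _ (mem_image_of_mem γ ht)

/-! ### Control of the quotient on the whole interval and the terminal cost -/

/-- For parameters close to `u`, the chart quotient is defined on all of `[0, T]`, solves the
equation of `quotientField`, and is Lipschitz in the parameter at `u`. -/
theorem exists_chartQuotient_bound [LieGroup I ∞ G] [T2Space G] [ProperSpace E]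
    {F : (x : G) → U → TangentSpace I x}
    (hF : ContMDiff (I.prod J) I.tangent 1
      (fun p : G × U => (⟨p.1, F p.1 p.2⟩ : TangentBundle I G)))
    {T : ℝ} (hT : 0 < T) {g₀ : G} {g : U → ℝ → G} (hg₀ : ∀ u, g u 0 = g₀)
    (hg : ∀ u, IsMIntegralCurveOn (g u) (fun x => F x u) (Icc 0 T)) (u : U) :
    ∃ c : ℝ, ∀ᶠ w in 𝓝 (extChartAt J u u), ∀ t ∈ Icc 0 T,
      (g u t)⁻¹ * g ((extChartAt J u).symm w) t ∈ (extChartAt I (1 : G)).source ∧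
      ‖chartQuotient I J g u w t - unitPt I G‖ ≤ ‖w - extChartAt J u u‖ * c := by
  have : IsTopologicalGroup G := topologicalGroup_of_lieGroup I ∞
  have hgc : ∀ w, ContinuousOn (g w) (Icc 0 T) := fun w t ht => (hg w t ht).1
  have hL : ContinuousOn (fun t => quotientDeriv J F u (g u t)) (Icc 0 T) := fun t ht =>
    ContinuousAt.comp_continuousWithinAt (f := g u) (quotientField_expansion hF u (g u t)).1
      (hgc u t ht)
  obtain ⟨M, hM, hMb⟩ := exists_bound_of_uniform_expansion
    (Φ := fun t x w => quotientField J F u (g u t) (x, w)) hL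
    (fun ε hε => quotientField_uniform_expansion hF u isCompact_Icc (hgc u) hε)
  obtain ⟨r₁, hr₁, hb⟩ := Metric.eventually_nhds_iff.1 hMb
  obtain ⟨r₂, hr₂, htgt⟩ := Metric.isOpen_iff.1 (isOpen_extChartAt_target (I := I) (1 : G))
    (unitPt I G) unitPt_mem_target
  -- `r₁` keeps the linear bound on the field valid, `r₂` keeps the ball inside the chart.
  let r := min r₁ r₂
  have hr : 0 < r := lt_min hr₁ hr₂
  let W := (extChartAt I (1 : G)).source ∩ extChartAt I (1 : G) ⁻¹' Metric.ball (unitPt I G) r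
  let S := (extChartAt I (1 : G)).symm '' Metric.closedBall (unitPt I G) (r / 2)
  have hsub : Metric.closedBall (unitPt I G) (r / 2) ⊆ (extChartAt I (1 : G)).target := fun x hx =>
    htgt (Metric.closedBall_subset_ball ((half_lt_self hr).trans_le (min_le_right _ _)) hx)
  have hW : IsOpen W := (continuousOn_extChartAt (1 : G)).isOpen_inter_preimage
    (isOpen_extChartAt_source 1) Metric.isOpen_ball
  -- Closed in `G`, not only in the chart: a compact set in a Hausdorff space.
  have hS : IsClosed S := ((isCompact_closedBall _ _).image_of_continuousOn
    ((continuousOn_extChartAt_symm (1 : G)).mono hsub)).isClosed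
  have hSW : S ⊆ W := by
    rintro _ ⟨x, hx, rfl⟩
    refine ⟨(extChartAt I (1 : G)).map_target (hsub hx), ?_⟩
    rw [mem_preimage, (extChartAt I (1 : G)).right_inv (hsub hx)]
    exact Metric.closedBall_subset_ball (half_lt_self hr) hx
  refine ⟨Real.exp (M * T), ?_⟩
  have hnear : ∀ᶠ w in 𝓝 (extChartAt J u u),
      ‖w - extChartAt J u u‖ * Real.exp (M * T) < r / 2 := by
    have hc : Continuous fun w => ‖w - extChartAt J u u‖ * Real.exp (M * T) := by fun_prop
    exact (hc.tendsto _).eventually_lt_const (by simpa using half_pos hr)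
  filter_upwards [hnear, Metric.ball_mem_nhds _ hr₁] with w hw hwr
  -- While the quotient stays in `W`, Grönwall bounds it by less than `r/2`, that is, it lies in
  -- `S`; so it never leaves.
  have hgr : ∀ b ∈ Icc 0 T, (∀ s ∈ Icc 0 b, (g u s)⁻¹ * g ((extChartAt J u).symm w) s ∈ W) →
      ‖chartQuotient I J g u w b - unitPt I G‖ ≤ ‖w - extChartAt J u u‖ * Real.exp (M * T) := by
    intro b hb' hs
    have h1 := norm_sub_le_of_norm_deriv_le_mul_add (y := chartQuotient I J g u w)
      (y' := fun t => quotientField J F u (g u t) (chartQuotient I J g u w t, w))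
      (x₀ := unitPt I G) hM hb'.1 (norm_nonneg (w - extChartAt J u u))
      (by simp only [chartQuotient, hg₀, inv_mul_cancel]; rfl)
      (fun t ht => (hasDerivWithinAt_chartQuotient hT hg u ⟨ht.1, ht.2.trans hb'.2⟩
        (hs t ht).1).mono (Icc_subset_Icc le_rfl hb'.2))
      (fun t ht => hb (y := (chartQuotient I J g u w t, w))
        (max_lt (lt_of_lt_of_le (hs t ht).2 (min_le_left _ _)) hwr) t ⟨ht.1, ht.2.trans hb'.2⟩)
    refine h1.trans ?_
    gcongr
    exact hb'.2
  have hmem := forall_mem_Icc_of_no_exit (T := T)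
    (h := fun s => (g u s)⁻¹ * g ((extChartAt J u).symm w) s)
    ((hgc u).inv.mul (hgc _)) hW hS hSW
    (by
      refine ⟨unitPt I G, Metric.mem_closedBall_self (half_pos hr).le, ?_⟩
      simp only [hg₀, inv_mul_cancel, symm_unitPt])
    (fun b hb' hs => by
      refine ⟨chartQuotient I J g u w b, ?_, ?_⟩
      · rw [mem_closedBall_iff_norm]
        exact (hgr b hb' hs).trans hw.le
      · exact (extChartAt I (1 : G)).left_inv (hs b ⟨hb'.1, le_rfl⟩).1)
  exact fun t ht => ⟨(hSW (hmem t ht)).1, hgr t ht fun s hs =>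
    hSW (hmem s ⟨hs.1, hs.2.trans ht.2⟩)⟩

/-- The derivative with respect to the parameter of a terminal cost, in the chart around `u`. -/
theorem hasFDerivAt_terminal_cost [LieGroup I ∞ G] [T2Space G] [ProperSpace E]
    {F : (x : G) → U → TangentSpace I x}
    (hF : ContMDiff (I.prod J) I.tangent 1
      (fun p : G × U => (⟨p.1, F p.1 p.2⟩ : TangentBundle I G)))
    {C : G → ℝ} (hC : MDifferentiable I 𝓘(ℝ, ℝ) C)
    {T : ℝ} (hT : 0 < T) {g₀ : G} {g : U → ℝ → G} (hg₀ : ∀ u, g u 0 = g₀)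
    (hg : ∀ u, IsMIntegralCurveOn (g u) (fun x => F x u) (Icc 0 T)) (u : U)
    {μ : ℝ → E →L[ℝ] ℝ} (hμT : μ T = leftDeriv I C (g u T))
    (hμ : ∀ t ∈ Icc 0 T, HasDerivWithinAt μ
      (-(μ t).comp ((quotientDeriv J F u (g u t)).comp (.inl ℝ E V))) (Icc 0 T) t) :
    HasFDerivAt (fun w => C (g ((extChartAt J u).symm w) T))
      (∫ t in (0 : ℝ)..T, (μ t).comp ((quotientDeriv J F u (g u t)).comp (.inr ℝ E V)))
      (extChartAt J u u) := by
  have hgc : ContinuousOn (g u) (Icc 0 T) := fun t ht => (hg u t ht).1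
  have hL : ContinuousOn (fun t => quotientDeriv J F u (g u t)) (Icc 0 T) := fun t ht =>
    ContinuousAt.comp_continuousWithinAt (f := g u) (quotientField_expansion hF u (g u t)).1
      (hgc t ht)
  obtain ⟨c, hc⟩ := exists_chartQuotient_bound hF hT hg₀ hg u
  have hTm : T ∈ Icc 0 T := ⟨hT.le, le_rfl⟩
  have h1 := hasFDerivAt_of_adjoint (x₀ := unitPt I G) (w₀ := extChartAt J u u)
    (Φ := fun t x w => quotientField J F u (g u t) (x, w)) hT.le hL
    (fun ε hε => quotientField_uniform_expansion hF u isCompact_Icc hgc hε)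
    (y := chartQuotient I J g u)
    (fun w => by simp only [chartQuotient, hg₀, inv_mul_cancel]; rfl)
    (hc.mono fun w hw t ht => hasDerivWithinAt_chartQuotient hT hg u ht (hw t ht).1)
    (hc.mono fun w hw t ht => (hw t ht).2) hμ
  rw [hμT] at h1
  have h2 : HasFDerivAt (fun w => C (g u T * (extChartAt I (1 : G)).symm (chartQuotient I J g u w T)))
      _ (extChartAt J u u) :=
    HasFDerivAt.comp_of_isBigO (z := fun w => chartQuotient I J g u w T) (y₀ := unitPt I G)
      (by simp only [chartQuotient, extChartAt_to_inv, inv_mul_cancel]; rfl)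
      (hasFDerivAt_comp_mul_symm (hC (g u T)))
      (Asymptotics.IsBigO.of_bound c (hc.mono fun w hw => by
        rw [mul_comm]; exact (hw T hTm).2)) h1
  refine h2.congr_of_eventuallyEq ?_
  filter_upwards [hc] with w hw
  rw [chartQuotient, (extChartAt I (1 : G)).left_inv (hw T hTm).1, mul_inv_cancel_left]

/-- The right-hand side of the adjoint equation is minus the transpose of the linearization in
the chart around the identity. -/
theorem adjoint_rhs [FiniteDimensional ℝ E] [LieGroup I ∞ G] {F : (x : G) → U → TangentSpace I x}
    (hF : ContMDiff (I.prod J) I.tangent 1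
      (fun p : G × U => (⟨p.1, F p.1 p.2⟩ : TangentBundle I G))) (u : U) (a : G)
    {ξ : GroupLieAlgebra I G} (hξ : ξ = leftField F a u) (ν : GroupLieAlgebra I G →L[ℝ] ℝ)
    {ν' : E →L[ℝ] ℝ} (hν : ν = ν') :
    @Eq (GroupLieAlgebra I G →L[ℝ] ℝ) (coad ξ ν - leftTrivDual a (ν.comp (leftFieldDg F a u)))
      (-(ν'.comp ((quotientDeriv J F u a).comp (.inl ℝ E V)))) := by
  subst hξ hν
  refine ContinuousLinearMap.ext fun δ => ?_
  have h1 : ν (quotientDeriv J F u a (δ, 0)) =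
      ν (leftFieldDg F a u (tangentLeft a δ)) - ν ⁅leftField F a u, δ⁆ :=
    (congrArg ν (quotientDeriv_inl hF u a δ)).trans (map_sub ν _ _)
  have h2 : ν ⁅leftField F a u, δ⁆ - ν (leftFieldDg F a u (tangentLeft a δ)) =
      -(ν (quotientDeriv J F u a (δ, 0))) := by rw [h1, neg_sub]
  exact h2

end LieGroupChart

/-! ### The adjoint gradient formula -/

theorem mainTheorem5
    {E : Type*} [NormedAddCommGroup E] [NormedSpace ℝ E] [FiniteDimensional ℝ E]
    {H : Type*} [TopologicalSpace H] (I : ModelWithCorners ℝ E H) [I.Boundaryless]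
    {G : Type*} [TopologicalSpace G] [ChartedSpace H G] [Group G] [LieGroup I ∞ G] [T2Space G]
    {V : Type*} [NormedAddCommGroup V] [NormedSpace ℝ V]
    {K : Type*} [TopologicalSpace K] (J : ModelWithCorners ℝ V K) [J.Boundaryless]
    {U : Type*} [TopologicalSpace U] [ChartedSpace K U] [IsManifold J 1 U]
    (F : (x : G) → U → TangentSpace I x)
    (hF : ContMDiff (I.prod J) I.tangent 1
      (fun p : G × U => (⟨p.1, F p.1 p.2⟩ : TangentBundle I G)))
    (C : G → ℝ) (hC : MDifferentiable I 𝓘(ℝ, ℝ) C)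
    (T : ℝ) (hT : 0 < T) (g₀ : G)
    (g : U → ℝ → G)
    (hg₀ : ∀ u, g u 0 = g₀)
    (hg : ∀ u, IsMIntegralCurveOn (g u) (fun x => F x u) (Icc 0 T))
    (u : U) :
    (∃ μ : ℝ → (GroupLieAlgebra I G →L[ℝ] ℝ), IsAdjointSolution F C T u (g u) μ) ∧
    ∀ μ : ℝ → (GroupLieAlgebra I G →L[ℝ] ℝ), IsAdjointSolution F C T u (g u) μ →
      MDifferentiableAt J 𝓘(ℝ, ℝ) (fun w => C (g w T)) u ∧
      MDifferentiableAt J 𝓘(ℝ, ℝ) (fun w => augmentedCost F C T μ (g w) w) u ∧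
      ∀ v : TangentSpace J u,
        IntervalIntegrable (fun t => μ t (leftFieldDu J F (g u t) u v)) volume 0 T ∧
        mfderiv J 𝓘(ℝ, ℝ) (fun w => C (g w T)) u v =
          mfderiv J 𝓘(ℝ, ℝ) (fun w => augmentedCost F C T μ (g w) w) u v ∧
        mfderiv J 𝓘(ℝ, ℝ) (fun w => augmentedCost F C T μ (g w) w) u v =
          ∫ t in (0 : ℝ)..T, μ t (leftFieldDu J F (g u t) u v) := by
  have : ProperSpace E := FiniteDimensional.proper ℝ E
  have hgc : ContinuousOn (g u) (Icc 0 T) := fun t ht => (hg u t ht).1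
  have hL : ContinuousOn (fun t => quotientDeriv J F u (g u t)) (Icc 0 T) := fun t ht =>
    ContinuousAt.comp_continuousWithinAt (f := g u) (quotientField_expansion hF u (g u t)).1
      (hgc t ht)
  constructor
  -- Minus the transpose of the linearization: the adjoint equation reads `μ' = A μ`.
  · let A : ℝ → (E →L[ℝ] ℝ) →L[ℝ] (E →L[ℝ] ℝ) := fun t =>
      -((ContinuousLinearMap.compL ℝ E E ℝ).flip ((quotientDeriv J F u (g u t)).comp (.inl ℝ E V)))
    have hA : ContinuousOn A (Icc 0 T) :=
      (((ContinuousLinearMap.compL ℝ E E ℝ).flip.continuous.comp_continuousOn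
        (hL.clm_comp continuousOn_const))).neg
    obtain ⟨μ, hμT, hμ⟩ := exists_linear_ode hT.le hA (leftDeriv I C (g u T))
    refine ⟨μ, fun t ht => ⟨A t (μ t), hμ t ht, ?_⟩, hμT⟩
    have h := adjoint_rhs hF u (g u t) (leftVelocity_eq_leftField hT (hg u) ht) (μ t) rfl
    rw [add_sub_assoc]
    exact (congrArg (fun x => -(A t (μ t)) + x) h).trans (neg_add_cancel _)
  · intro μ' hμ'
    -- The same curve, with values regarded as functionals on the underlying space `E` of `𝔤`.
    obtain ⟨μ, hμμ⟩ : ∃ μ : ℝ → (E →L[ℝ] ℝ), μ = μ' := ⟨μ', rfl⟩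
    have hμ : ∀ t ∈ Icc 0 T, HasDerivWithinAt μ
        (-(μ t).comp ((quotientDeriv J F u (g u t)).comp (.inl ℝ E V))) (Icc 0 T) t := by
      intro t ht
      obtain ⟨ν, hν, heq⟩ := hμ'.adjoint_eq t ht
      have h := adjoint_rhs hF u (g u t) (leftVelocity_eq_leftField hT (hg u) ht) (μ' t)
        (congrFun hμμ t).symm
      rw [add_sub_assoc] at heq
      have e := neg_add_eq_zero.1 ((congrArg (-ν + ·) h).symm.trans heq)
      subst e hμμ
      exact hν
    have hμT : μ T = leftDeriv I C (g u T) := hμμ ▸ hμ'.terminal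
    have hJ : (fun w => augmentedCost F C T μ' (g w) w) = fun w => C (g w T) :=
      funext fun w => augmentedCost_eq hT (hg w) μ'
    rw [hJ]
    have hder := hasFDerivAt_terminal_cost hF hC hT hg₀ hg u hμT hμ
    have hm : HasMFDerivAt J 𝓘(ℝ, ℝ) (fun w => C (g w T)) u
        (∫ t in (0 : ℝ)..T, (μ t).comp ((quotientDeriv J F u (g u t)).comp (.inr ℝ E V)) :
          V →L[ℝ] ℝ) := by
      -- The manifold derivative at `u` is by definition the derivative in the chart around `u`;
      -- only continuity has to be carried back to `U`.
      refine ⟨?_, hder.hasFDerivWithinAt⟩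
      have h1 : ContinuousAt (fun w => C (g ((extChartAt J u).symm (extChartAt J u w)) T)) u :=
        ContinuousAt.comp (f := extChartAt J u) hder.continuousAt (continuousAt_extChartAt u)
      refine h1.congr ?_
      filter_upwards [extChartAt_source_mem_nhds (I := J) u] with w hw
      rw [(extChartAt J u).left_inv hw]
    have hμc : ContinuousOn μ (Icc 0 T) := fun t ht => (hμ t ht).continuousWithinAt
    have hint : ContinuousOn
        (fun t => (μ t).comp ((quotientDeriv J F u (g u t)).comp (.inr ℝ E V))) (Icc 0 T) :=
      hμc.clm_comp (hL.clm_comp continuousOn_const)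
    refine ⟨hm.mdifferentiableAt, hm.mdifferentiableAt, fun v => ?_⟩
    have hfun : (fun t => μ' t (leftFieldDu J F (g u t) u v)) =
        fun t => ((μ t).comp ((quotientDeriv J F u (g u t)).comp (.inr ℝ E V))) v := by
      funext t
      subst hμμ
      exact congrArg (μ t) (quotientDeriv_inr hF u (g u t) v).symm
    refine ⟨?_, rfl, ?_⟩
    · rw [hfun]
      exact (hint.clm_apply continuousOn_const).intervalIntegrable_of_Icc hT.le
    · rw [hfun]
      refine (DFunLike.congr_fun hm.mfderiv v).trans ?_
      exact ContinuousLinearMap.intervalIntegral_apply (hint.intervalIntegrable_of_Icc hT.le) v
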